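/- **Setting.** A *matrix algebra with involution of rank $r$* is a finite-dimensional real algebra $\mathcal A$ (not necessarily associative) with a decomposition $\mathcal A=\bigoplus_{i,j=1}^r\mathcal A_{ij}$ into subspaces, where $\mathcal A_{ij}\mathcal A_{jk}\subseteq\mathcal A_{ik}$ and $\mathcal A_{ij}\mathcal A_{kl}=\{0\}$ for $j\ne k$, and with a linear involution $*$ satisfying $a^{**}=a$, $(ab)^*=b^*a^*$, $\mathcal A_{ij}^*=\mathcal A_{ji}$. Write $a_{ij}$ for the component of $a$ in $\mathcal A_{ij}$. It is a *T-algebra of rank $r$* if (a1) each $\mathcal A_{ii}$ is a subalgebra isomorphic to $\mathbb R$, by an isomorphism $\rho_i$; put $e_i=\rho_i^{-1}(1)$ and $\operatorname{tr}a=\sum_i\rho_i(a_{ii})$; and, for all $a,b,c\in\mathcal A$: (a2) $e_ia_{ij}=a_{ij}$, $a_{ji}e_i=a_{ji}$; (a3) $\operatorname{tr}(ab)=\operatorname{tr}(ba)$; (a4) $\operatorname{tr}((ab)c)=\operatorname{tr}(a(bc))$; (a5) $\operatorname{tr}(aa^*)\ge0$, with equality iff $a=0$; (a6) $a_{ij}(b_{jk}c_{kl})=(a_{ij}b_{jk})c_{kl}$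 for $i\le j\le k\le l$; (a7) $a_{ij}(b_{jk}b_{lk}^*)=(a_{ij}b_{jk})b_{lk}^*$ for $i\le j\le k$, $l\le k$. Let $\mathcal H(\mathcal A)=\{a: a^*=a\}$ with inner product $\langle a,b\rangle=\operatorname{tr}(ab^*)$. Let $UT_{++}$ be the set of upper triangular $a$ ($a_{ij}=0$ for $i>j$) with all $\rho_i(a_{ii})>0$, and let $LT_{++}$ (resp. $LT_+$) be the set of lower triangular $a$ ($a_{ij}=0$ for $i<j$) with all $\rho_i(a_{ii})>0$ (resp. $\ge0$). Put $$K(\mathcal A)=\{tt^*: t\in UT_{++}\},\qquad K(\mathcal A)^*=\{y\in\mathcal H(\mathcal A):\langle x,y\rangle\ge0\ \ \forall x\in K(\mathcal A)\}.$$ For $a\in\mathcal A$ let $Q_a:\mathcal H(\mathcal A)\to\mathcal H(\mathcal A)$ be the linear map $Q_a(b)=\tfrac12(w+w^*)$, $w=a(ba^*)+a(ab)-(aa)b$. An *automorphism* of a cone $C$ is a linear bijection of the ambient space mapping $C$ onto $C$; a *triangular automorphism* of $K(\mathcal A)^*$ is an automorphism of the form $Q_l$ with $l\in LT_{++}$.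 For $I\subseteq\{1,\dots,r\}$ let $\mathcal A_I=\{a: a_{ik}=a_{ki}=0\ \ \forall i\in I,\ \forall k\}$, a T-algebra of rank $r-|I|$ graded by the indices not in $I$, and let $LT_{+}(\mathcal A_I)$ (resp. $LT_{++}(\mathcal A_I)$) be the set of lower triangular $t\in\mathcal A_I$ with $\rho_i(t_{ii})\ge0$ (resp. $>0$) for all $i\notin I$. Put $K^D(\mathcal A_I)=\{tt^*: t\in LT_{++}(\mathcal A_I)\}$. An element $t\in LT_+$ is *proper* if $\rho_i(t_{ii})=0$ implies $t_{ki}=0$ for all $k$. A *face* of a convex cone $C$ is a nonempty convex cone $F\subseteq C$ such that $x,y\in C$, $x+y\in F$ imply $x,y\in F$; it is proper if $F\ne C$, and *projectionally exposed* if $P(C)=F$ for some linear map $P$ of the ambient space with $P^2=P$. A convex cone is *homogeneous* if its automorphisms act transitively on its relative interior. The *rank* of a pointed homogeneous cone is the rank of any T-algebra $\mathcal B$ such that the relative interior of the cone is linearly isomorphic to $K(\mathcal B)$; that this number exists and is unique is, for the cone $F$ below, part of the claim. **Theorem.** Let $\mathcal A$ be a T-algebra of rank $r$ and let $F$ be a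 proper face of $K(\mathcal A)^*$. 1. $F$ is projectionally exposed. 2. $F$ is a homogeneous cone of rank $s$ for some $s<r$, and there are a triangular automorphism $Q$ of $K(\mathcal A)^*$ and a nonempty $I\subseteq\{1,\dots,r\}$ such that $$Q(F)=\overline{K^D(\mathcal A_I)}=\{tt^*: t\in LT_+(\mathcal A_I)\}.$$ Furthermore, each $x\in\operatorname{ri}F$ can be written as $x=tt^*$ for a unique proper $t\in LT_+$, and for every triangular automorphism $Q$ of $K(\mathcal A)^*$ and every $I\subseteq\{1,\dots,r\}$ with $Q(F)=\overline{K^D(\mathcal A_I)}$, and every $x\in \operatorname{ri}F$ with $x=tt^*$, $t$ proper, one has $I=\{i:\rho_i(t_{ii})=0\}$ and $s=r-|I|$. 3. There is a group $\mathcal G$ of automorphisms of $F$ (linear bijections of $\operatorname{span}F$ mapping $F$ onto $F$) that acts simply transitively on $\operatorname{ri}F$, such that each $g\in\mathcal G$ agrees on $F$ with a triangular automorphism of $K(\mathcal A)^*$. -/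

import Mathlib

open scoped BigOperators

/-- A matrix algebra of rank `r` with involution: a (not necessarily associative or unital) real
algebra `A` with an involution `star`, which is the internal direct sum of subspaces
`grade i j`, multiplied like blocks of matrices and transposed by the involution. -/
structure MatrixAlgebra (r : ℕ) (A : Type*) [NonUnitalNonAssocRing A] [StarRing A]
    [Module ℝ A] where
  /-- the subspace in position `(i, j)` -/
  grade : Fin r → Fin r → Submodule ℝ A
  isInternal : DirectSum.IsInternal (fun p : Fin r × Fin r => grade p.1 p.2)
  mul_mem : ∀ {i j k : Fin r} {a b : A}, a ∈ grade i j → b ∈ grade j k → a * b ∈ grade i k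
  mul_eq_zero : ∀ {i j k l : Fin r} {a b : A}, j ≠ k → a ∈ grade i j → b ∈ grade k l → a * b = 0
  star_mem : ∀ {i j : Fin r} {a : A}, a ∈ grade i j → star a ∈ grade j i

/-- The `(i, j)` component of an element of a matrix algebra. -/
noncomputable def MatrixAlgebra.comp {r : ℕ} {A : Type*} [NonUnitalNonAssocRing A] [StarRing A]
    [Module ℝ A] (M : MatrixAlgebra r A) (i j : Fin r) : A →ₗ[ℝ] M.grade i j :=
  (DirectSum.component ℝ (Fin r × Fin r) (fun p => M.grade p.1 p.2) (i, j)) ∘ₗ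
    (LinearEquiv.ofBijective
      (DirectSum.coeLinearMap (fun p : Fin r × Fin r => M.grade p.1 p.2))
      M.isInternal).symm.toLinearMap

/-- A matrix algebra whose diagonal blocks are identified with `ℝ` by algebra isomorphisms
(which are unique, as `ℝ` has no other real algebra automorphism than the identity). -/
structure DiagMatrixAlgebra (r : ℕ) (A : Type*) [NonUnitalNonAssocRing A] [StarRing A]
    [Module ℝ A] extends MatrixAlgebra r A where
  /-- the algebra isomorphism of the `i`-th diagonal block with `ℝ` -/
  rho : ∀ i : Fin r, grade i i ≃ₗ[ℝ] ℝ
  rho_mul : ∀ (i : Fin r) (a b : grade i i),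
    rho i ⟨(a : A) * (b : A), mul_mem a.2 b.2⟩ = rho i a * rho i b

namespace DiagMatrixAlgebra

variable {r : ℕ} {A : Type*} [NonUnitalNonAssocRing A] [StarRing A] [Module ℝ A]

/-- The `i`-th diagonal coefficient `ρ_i(a_ii)`, a linear functional of `a`. -/
noncomputable def diag (T : DiagMatrixAlgebra r A) (i : Fin r) : A →ₗ[ℝ] ℝ :=
  (T.rho i).toLinearMap ∘ₗ T.comp i i

/-- The unit element `e_i` of the `i`-th diagonal block. -/
noncomputable def e (T : DiagMatrixAlgebra r A) (i : Fin r) : A := ((T.rho i).symm 1 : T.grade i i)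

/-- The trace `∑ i, ρ_i(a_ii)`. -/
noncomputable def tr (T : DiagMatrixAlgebra r A) : A →ₗ[ℝ] ℝ := ∑ i, T.diag i

end DiagMatrixAlgebra

/-- T-algebras of rank `r` in the sense of Vinberg. -/
structure TAlgebra (r : ℕ) (A : Type*) [NonUnitalNonAssocRing A] [StarRing A]
    [Module ℝ A] extends DiagMatrixAlgebra r A where
  e_mul : ∀ (i j : Fin r) (a : A), a ∈ grade i j → toDiagMatrixAlgebra.e i * a = a
  mul_e : ∀ (i j : Fin r) (a : A), a ∈ grade j i → a * toDiagMatrixAlgebra.e i = a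
  tr_mul_comm : ∀ a b : A, toDiagMatrixAlgebra.tr (a * b) = toDiagMatrixAlgebra.tr (b * a)
  tr_mul_assoc : ∀ a b c : A,
    toDiagMatrixAlgebra.tr ((a * b) * c) = toDiagMatrixAlgebra.tr (a * (b * c))
  tr_mul_star_nonneg : ∀ a : A, 0 ≤ toDiagMatrixAlgebra.tr (a * star a)
  tr_mul_star_eq_zero : ∀ a : A, toDiagMatrixAlgebra.tr (a * star a) = 0 ↔ a = 0
  mul_assoc_upper : ∀ (i j k l : Fin r) (a b c : A), i ≤ j → j ≤ k → k ≤ l →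
    a ∈ grade i j → b ∈ grade j k → c ∈ grade k l → a * (b * c) = (a * b) * c
  mul_assoc_star : ∀ (i j k l : Fin r) (a b c : A), i ≤ j → j ≤ k → l ≤ k →
    a ∈ grade i j → b ∈ grade j k → c ∈ grade l k → a * (b * star c) = (a * b) * star c

/-- The space of Hermitian elements `a = a^*`. -/
abbrev Herm (A : Type*) [NonUnitalNonAssocRing A] [StarRing A] [Module ℝ A] [StarModule ℝ A] :
    Submodule ℝ A := selfAdjoint.submodule ℝ A

/-- The Hermitian element `t t^*`. -/
def mulStar {A : Type*} [NonUnitalNonAssocRing A] [StarRing A] [Module ℝ A] [StarModule ℝ A]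
    (t : A) : Herm A :=
  ⟨t * star t, by
    change star (t * star t) = t * star t
    rw [star_mul, star_star]⟩

/-- The quadratic map `Q_a(b) = (w + w^*) / 2`, where `w = a (b a^*) + a (a b) - (a a) b`. -/
noncomputable def quadMap {A : Type*} [NonUnitalNonAssocRing A] [StarRing A] [Module ℝ A]
    [IsScalarTower ℝ A A] [SMulCommClass ℝ A A] [StarModule ℝ A] (a : A) :
    Herm A →ₗ[ℝ] Herm A where
  toFun b :=
    ⟨(1 / 2 : ℝ) • ((a * ((b : A) * star a) + a * (a * (b : A)) - (a * a) * (b : A)) +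
        star (a * ((b : A) * star a) + a * (a * (b : A)) - (a * a) * (b : A))), by
      change star _ = _
      rw [star_smul, star_add, star_star, star_trivial, add_comm]⟩
  map_add' b c := by
    apply Subtype.ext
    simp only [Submodule.coe_add, add_mul, mul_add, star_add, star_sub]
    rw [← smul_add]
    congr 1
    abel
  map_smul' c b := by
    apply Subtype.ext
    simp only [Submodule.coe_smul, smul_mul_assoc, mul_smul_comm, RingHom.id_apply]
    rw [smul_comm c]
    congr 1
    rw [← smul_add, ← smul_sub, star_smul, star_trivial c, ← smul_add]

namespace TAlgebra

variable {r : ℕ} {A : Type*} [NonUnitalNonAssocRing A] [StarRing A] [Module ℝ A]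

/-- Upper triangular elements with positive diagonal. -/
def UTpp (T : TAlgebra r A) : Set A :=
  {a | (∀ i j, j < i → T.comp i j a = 0) ∧ ∀ i, 0 < T.diag i a}

/-- Lower triangular elements with positive diagonal. -/
def LTpp (T : TAlgebra r A) : Set A :=
  {a | (∀ i j, i < j → T.comp i j a = 0) ∧ ∀ i, 0 < T.diag i a}

/-- Lower triangular elements with nonnegative diagonal. -/
def LTp (T : TAlgebra r A) : Set A :=
  {a | (∀ i j, i < j → T.comp i j a = 0) ∧ ∀ i, 0 ≤ T.diag i a}

/-- A lower triangular element with nonnegative diagonal is proper if each of its columns with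
vanishing diagonal entry vanishes. -/
def IsProperLT (T : TAlgebra r A) (t : A) : Prop :=
  t ∈ T.LTp ∧ ∀ i, T.diag i t = 0 → ∀ k, T.comp k i t = 0

/-- The principal subalgebra `A_I`: the rows and columns with index in `I` vanish. It is a
T-algebra of rank `r - |I|`, graded by the remaining indices in increasing order. -/
def principal (T : TAlgebra r A) (I : Finset (Fin r)) : Set A :=
  {a | ∀ i ∈ I, ∀ k, T.comp i k a = 0 ∧ T.comp k i a = 0}

/-- `LT_+(A_I)`, where the diagonal of `A_I` is indexed by the complement of `I`. -/
def principalLTp (T : TAlgebra r A) (I : Finset (Fin r)) : Set A :=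
  {a | a ∈ T.principal I ∧ (∀ i j, i < j → T.comp i j a = 0) ∧ ∀ i ∉ I, 0 ≤ T.diag i a}

/-- `LT_{++}(A_I)`, where the diagonal of `A_I` is indexed by the complement of `I`. -/
def principalLTpp (T : TAlgebra r A) (I : Finset (Fin r)) : Set A :=
  {a | a ∈ T.principal I ∧ (∀ i j, i < j → T.comp i j a = 0) ∧ ∀ i ∉ I, 0 < T.diag i a}

variable [StarModule ℝ A]

/-- The open homogeneous cone `K(A) = {t t^* : t ∈ UT_{++}}` in the Hermitian elements. -/
def cone (T : TAlgebra r A) : Set (Herm A) := mulStar '' T.UTpp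

/-- The cone `K^D(A_I) = {t t^* : t ∈ LT_{++}(A_I)}`. -/
def principalDual (T : TAlgebra r A) (I : Finset (Fin r)) : Set (Herm A) :=
  mulStar '' T.principalLTpp I

variable [IsScalarTower ℝ A A] [SMulCommClass ℝ A A]

/-- The inner product `⟨a, b⟩ = tr (a b^*)`, restricted to the Hermitian elements. -/
noncomputable def inner (T : TAlgebra r A) : Herm A →ₗ[ℝ] Herm A →ₗ[ℝ] ℝ :=
  LinearMap.mk₂ ℝ (fun a b => T.tr ((a : A) * star (b : A)))
    (fun a a' b => by simp [add_mul])
    (fun c a b => by simp [smul_mul_assoc])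
    (fun a b b' => by simp [mul_add])
    (fun c a b => by simp [mul_smul_comm])

/-- The dual cone `K(A)^*`, taken in the space of Hermitian elements. -/
noncomputable def dualCone (T : TAlgebra r A) : PointedCone ℝ (Herm A) :=
  PointedCone.dual T.inner T.cone

end TAlgebra

/-- Automorphisms of a set `K` (a cone): linear bijections of the ambient space mapping `K`
onto `K`. -/
def IsConeAut {E : Type*} [AddCommGroup E] [Module ℝ E] (K : Set E) (Q : E →ₗ[ℝ] E) : Prop :=
  Function.Bijective Q ∧ Q '' K = K

/-- Triangular automorphisms of the dual cone: the automorphisms of the form `Q_l`, where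
`l ∈ LT_{++}`. -/
def TAlgebra.IsTriangularDualAut {r : ℕ} {A : Type*} [NonUnitalNonAssocRing A] [StarRing A]
    [Module ℝ A] [IsScalarTower ℝ A A] [SMulCommClass ℝ A A] [StarModule ℝ A]
    (T : TAlgebra r A) (Q : Herm A →ₗ[ℝ] Herm A) : Prop :=
  IsConeAut (T.dualCone : Set (Herm A)) Q ∧ ∃ l ∈ T.LTpp, Q = quadMap l

/-- Projectional exposedness of a face `F` of `K`. -/
def IsProjectionallyExposed {E : Type*} [AddCommGroup E] [Module ℝ E] (K F : Set E) : Prop :=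
  ∃ P : E →ₗ[ℝ] E, P '' K = F ∧ P ∘ₗ P = P

/-- Homogeneity of a convex cone: its automorphisms act transitively on its relative interior. -/
def IsHomogeneousCone {E : Type*} [AddCommGroup E] [Module ℝ E] [TopologicalSpace E]
    (K : Set E) : Prop :=
  ∀ x ∈ intrinsicInterior ℝ K, ∀ y ∈ intrinsicInterior ℝ K,
    ∃ Q : E →ₗ[ℝ] E, IsConeAut K Q ∧ Q x = y

/-- The relative interior of `C` is linearly isomorphic to the open cone of some T-algebra of
rank `s`. (The cone of a T-algebra spans the Hermitian elements, so `ψ` is a linear isomorphism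
onto the span of `C`.) -/
def IsRealizedInRank.{u} {E : Type u} [AddCommGroup E] [Module ℝ E] [TopologicalSpace E]
    (C : Set E) (s : ℕ) : Prop :=
  ∃ (B : Type u) (_ : NonUnitalNonAssocRing B) (_ : StarRing B) (_ : Module ℝ B)
    (_ : IsScalarTower ℝ B B) (_ : SMulCommClass ℝ B B) (_ : StarModule ℝ B)
    (_ : FiniteDimensional ℝ B) (S : TAlgebra s B) (ψ : Herm B →ₗ[ℝ] E),
    Function.Injective ψ ∧ ψ '' S.cone = intrinsicInterior ℝ C

/-- `s` is the rank of the pointed homogeneous cone `C`: the rank of every T-algebra whose cone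
is linearly isomorphic to the relative interior of `C`, where at least one such T-algebra
exists. -/
def HasHomogeneousRank.{u} {E : Type u} [AddCommGroup E] [Module ℝ E] [TopologicalSpace E]
    (C : Set E) (s : ℕ) : Prop :=
  IsRealizedInRank C s ∧ ∀ s', IsRealizedInRank C s' → s' = s

/-!
# Faces of the dual of a homogeneous cone

The proof rests on one symmetry of T-algebras. The number `tr (((a b) c - a (b c)) d)` changes only
its sign when `a, b, c, d` are permuted cyclically, and the involution reverses their order. Hence
the associativity axioms, which are imposed on some quadruples of indices only, propagate along the
dihedral group: the triple product of the blocks `(i, j)`, `(j, k)`, `(k, l)` associates unless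
`{i, k}` and `{j, l}` are strictly separated (`TAlgebra.assoc_of_not_separated`). This condition is
symmetric under reversal of the order of the indices, so lower triangular elements are as good as
upper triangular ones: `LT_{++}` is a group, `Q_l(b) = l (b l^*)` for lower triangular `l`,
`Q_l(t t^*) = (l t)(l t)^*`, `Q_l Q_m = Q_{lm}`, and `Q_l` preserves the dual cone
(`TAlgebra.quadMap_mem_dualCone`).

By elimination of one row after the other, every element of the dual cone is `t t^*` for a unique
proper `t` (`TAlgebra.exists_isProperLT`, `TAlgebra.IsProperLT.unique`). Filling the zeros on the
diagonal of `t` by ones gives `l ∈ LT_{++}` with `t t^* = Q_l(∑ i ∉ I, e_i)`, where `I` is the set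
of these zeros. So each face, being generated by any element of its relative interior, is the image
under a triangular automorphism of the face generated by `∑ i ∉ I, e_i`. The unit element is an
order unit, and compression to the blocks outside `I` shows that the latter face consists of all
elements of the dual cone whose rows in `I` vanish (`TAlgebra.mem_principalFace_iff`), that is, of
all `t t^*` with `t ∈ LT_+(A_I)`; the compression is also the exposing projection. The elements of
`LT_{++}` with trivial rows and columns in `I` act simply transitively on its relative interior
`K^D(A_I)`.

For the rank, `A_I` with its indices in reversed order is a T-algebra of rank `r - |I|` whose cone
is `K^D(A_I)` (`TAlgebra.principalEmbedding`). The rank of any realization is the length of the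
longest chain of faces: a strictly smaller face has a strictly larger set `I`
(`TAlgebra.IsProperLT.card_zeros_lt`), and the faces generated by `e_1 + ⋯ + e_i` form a chain of
the maximal length. This length depends on the cone only, so the rank is unique
(`IsRealizedInRank.unique`).
-/

set_option linter.unusedSectionVars false


/-! ### Components of a matrix algebra -/

namespace MatrixAlgebra

variable {r : ℕ} {A : Type*} [NonUnitalNonAssocRing A] [StarRing A] [Module ℝ A]

/-- The `(i, j)` component of `a`, as an element of the whole algebra. -/
noncomputable def cp (M : MatrixAlgebra r A) (i j : Fin r) : A →ₗ[ℝ] A :=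
  (M.grade i j).subtype ∘ₗ M.comp i j

theorem cp_mem (M : MatrixAlgebra r A) (i j : Fin r) (a : A) : M.cp i j a ∈ M.grade i j :=
  (M.comp i j a).2

theorem coe_comp (M : MatrixAlgebra r A) (i j : Fin r) (a : A) :
    (M.comp i j a : A) = M.cp i j a := rfl

theorem comp_eq_zero_iff (M : MatrixAlgebra r A) {i j : Fin r} {a : A} :
    M.comp i j a = 0 ↔ M.cp i j a = 0 := by
  rw [← coe_comp, ZeroMemClass.coe_eq_zero]

theorem cp_of_mem (M : MatrixAlgebra r A) {i j : Fin r} {a : A} (ha : a ∈ M.grade i j) :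
    M.cp i j a = a :=
  congrArg Subtype.val
    (DirectSum.IsInternal.ofBijective_coeLinearMap_of_mem (A := fun p : Fin r × Fin r =>
      M.grade p.1 p.2) M.isInternal (i := (i, j)) (x := a) ha)

theorem cp_of_mem_ne (M : MatrixAlgebra r A) {i j k l : Fin r} {a : A} (ha : a ∈ M.grade i j)
    (h : (i, j) ≠ (k, l)) : M.cp k l a = 0 :=
  congrArg Subtype.val
    (DirectSum.IsInternal.ofBijective_coeLinearMap_of_mem_ne (A := fun p : Fin r × Fin r =>
      M.grade p.1 p.2) M.isInternal (i := (i, j)) (j := (k, l)) h (x := a) ha)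

theorem sum_cp (M : MatrixAlgebra r A) (a : A) : ∑ i, ∑ j, M.cp i j a = a := by
  have ha : a ∈ ⨆ p : Fin r × Fin r, M.grade p.1 p.2 := by
    rw [M.isInternal.submodule_iSup_eq_top]; trivial
  induction ha using Submodule.iSup_induction' with
  | mem p x hx =>
    rw [Finset.sum_eq_single p.1, Finset.sum_eq_single p.2, M.cp_of_mem hx]
    · intro j _ hj
      exact M.cp_of_mem_ne hx (fun h => hj (congrArg Prod.snd h).symm)
    · simp
    · intro i _ hi
      exact Finset.sum_eq_zero fun j _ => M.cp_of_mem_ne hx fun h => hi (congrArg Prod.fst h).symm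
    · simp
  | zero => simp
  | add x y _ _ hx hy => simp only [map_add, Finset.sum_add_distrib, hx, hy]

theorem ext_cp (M : MatrixAlgebra r A) {a b : A} (h : ∀ i j, M.cp i j a = M.cp i j b) : a = b := by
  rw [← M.sum_cp a, ← M.sum_cp b]
  simp only [h]

theorem cp_cp (M : MatrixAlgebra r A) (i j k l : Fin r) (a : A) :
    M.cp i j (M.cp k l a) = if i = k ∧ j = l then M.cp k l a else 0 := by
  split_ifs with h
  · obtain ⟨rfl, rfl⟩ := h
    exact M.cp_of_mem (M.cp_mem _ _ _)
  · refine M.cp_of_mem_ne (M.cp_mem _ _ _) ?_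
    intro h'
    simp only [Prod.mk.injEq] at h'
    exact h ⟨h'.1.symm, h'.2.symm⟩

theorem cp_mul (M : MatrixAlgebra r A) (i j : Fin r) (a b : A) :
    M.cp i j (a * b) = ∑ k, M.cp i k a * M.cp k j b := by
  conv_lhs => rw [← M.sum_cp a, ← M.sum_cp b]
  simp only [Finset.sum_mul, Finset.mul_sum, map_sum]
  have key : ∀ p q s t : Fin r, M.cp i j (M.cp p q a * M.cp s t b) =
      if p = i then (if s = q then (if t = j then M.cp i q a * M.cp q j b else 0) else 0) else 0 := by
    intro p q s t
    by_cases hs : s = q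
    · subst hs
      by_cases h : p = i ∧ t = j
      · obtain ⟨rfl, rfl⟩ := h
        simp [M.cp_of_mem (M.mul_mem (M.cp_mem p s a) (M.cp_mem s t b))]
      · rw [M.cp_of_mem_ne (M.mul_mem (M.cp_mem p s a) (M.cp_mem s t b))
          (by simpa [Prod.mk.injEq] using h)]
        by_cases hp : p = i
        · have : t ≠ j := fun ht => h ⟨hp, ht⟩
          simp [this]
        · simp [hp]
    · rw [M.mul_eq_zero (Ne.symm hs) (M.cp_mem _ _ _) (M.cp_mem _ _ _)]
      simp [hs]
  simp only [key]
  simp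

theorem cp_star (M : MatrixAlgebra r A) (i j : Fin r) (a : A) :
    M.cp i j (star a) = star (M.cp j i a) := by
  conv_lhs => rw [← M.sum_cp a]
  simp only [star_sum, map_sum]
  rw [Finset.sum_eq_single j, Finset.sum_eq_single i]
  · exact M.cp_of_mem (M.star_mem (M.cp_mem _ _ _))
  · intro k _ hk
    exact M.cp_of_mem_ne (M.star_mem (M.cp_mem _ _ _)) (by simpa [Prod.mk.injEq] using hk)
  · simp
  · intro k _ hk
    refine Finset.sum_eq_zero fun l _ => ?_
    exact M.cp_of_mem_ne (M.star_mem (M.cp_mem _ _ _)) (by simp [Prod.mk.injEq, hk])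
  · simp

theorem cp_mul_star (M : MatrixAlgebra r A) (i j : Fin r) (a b : A) :
    M.cp i j (a * star b) = ∑ k, M.cp i k a * star (M.cp j k b) := by
  simp only [cp_mul, cp_star]

end MatrixAlgebra

namespace DiagMatrixAlgebra

variable {r : ℕ} {A : Type*} [NonUnitalNonAssocRing A] [StarRing A] [Module ℝ A]

theorem diag_eq_zero_of_cp (T : DiagMatrixAlgebra r A) {i : Fin r} {a : A}
    (h : T.cp i i a = 0) : T.diag i a = 0 := by
  simp [diag, T.comp_eq_zero_iff.2 h]

theorem e_mem (T : DiagMatrixAlgebra r A) (i : Fin r) : T.e i ∈ T.grade i i :=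
  ((T.rho i).symm 1).2

theorem cp_self (T : DiagMatrixAlgebra r A) (i : Fin r) (a : A) :
    T.cp i i a = T.diag i a • T.e i := by
  rw [← MatrixAlgebra.coe_comp]
  have : T.comp i i a = T.diag i a • (T.rho i).symm 1 := by
    apply (T.rho i).injective
    simp [diag]
  rw [this]; rfl

theorem diag_cp (T : DiagMatrixAlgebra r A) (i : Fin r) (a : A) :
    T.diag i (T.cp i i a) = T.diag i a := by
  have : T.comp i i (T.cp i i a) = T.comp i i a := by
    apply Subtype.ext
    rw [MatrixAlgebra.coe_comp, MatrixAlgebra.coe_comp, T.cp_of_mem (T.cp_mem _ _ _)]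
  simp [diag, this]

theorem diag_congr (T : DiagMatrixAlgebra r A) {i : Fin r} {a b : A}
    (h : T.cp i i a = T.cp i i b) : T.diag i a = T.diag i b := by
  rw [← diag_cp, h, diag_cp]

theorem diag_e (T : DiagMatrixAlgebra r A) (i : Fin r) : T.diag i (T.e i) = 1 := by
  have : T.comp i i (T.e i) = (T.rho i).symm 1 :=
    Subtype.ext (T.cp_of_mem (T.e_mem i))
  simp [diag, this]

theorem e_ne_zero (T : DiagMatrixAlgebra r A) (i : Fin r) : T.e i ≠ 0 := by
  intro h
  have := T.diag_e i
  simp [h] at this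

theorem cp_e (T : DiagMatrixAlgebra r A) (i j k : Fin r) :
    T.cp i j (T.e k) = if i = k ∧ j = k then T.e k else 0 := by
  split_ifs with h
  · obtain ⟨rfl, rfl⟩ := h
    exact T.cp_of_mem (T.e_mem _)
  · exact T.cp_of_mem_ne (T.e_mem _) (by
      intro h'; simp only [Prod.mk.injEq] at h'; exact h ⟨h'.1.symm, h'.2.symm⟩)

theorem diag_of_mem_ne (T : DiagMatrixAlgebra r A) {i j k : Fin r} {a : A}
    (ha : a ∈ T.grade i j) (h : (i, j) ≠ (k, k)) : T.diag k a = 0 :=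
  T.diag_eq_zero_of_cp (T.cp_of_mem_ne ha h)

theorem tr_apply (T : DiagMatrixAlgebra r A) (a : A) : T.tr a = ∑ i, T.diag i a := by
  simp [tr]

theorem tr_of_mem (T : DiagMatrixAlgebra r A) {i : Fin r} {a : A}
    (ha : a ∈ T.grade i i) : T.tr a = T.diag i a := by
  rw [tr_apply, Finset.sum_eq_single i]
  · intro j _ hj
    exact T.diag_of_mem_ne ha (by simp [Prod.mk.injEq, hj.symm])
  · simp

end DiagMatrixAlgebra

namespace TAlgebra

variable {r : ℕ} {A : Type*} [NonUnitalNonAssocRing A] [StarRing A] [Module ℝ A]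

theorem e_mul_e (T : TAlgebra r A) (i : Fin r) : T.e i * T.e i = T.e i :=
  T.e_mul i i _ (T.e_mem i)

theorem tr_eq_sum_cp (T : TAlgebra r A) (a d : A) :
    T.tr (a * d) = ∑ i, ∑ j, T.tr (T.cp i j a * T.cp j i d) := by
  have : ∀ i, T.diag i (a * d) = T.diag i (∑ j, T.cp i j a * T.cp j i d) := by
    intro i
    rw [← T.diag_cp, T.cp_mul]
  rw [T.tr_apply]
  refine Finset.sum_congr rfl fun i _ => ?_
  rw [this, map_sum]
  refine Finset.sum_congr rfl fun j _ => ?_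
  rw [T.tr_of_mem (T.mul_mem (T.cp_mem i j a) (T.cp_mem j i d))]

/-- The trace form pairs the blocks `(i, j)` and `(j, i)` nondegenerately. -/
theorem eq_zero_of_mem_of_tr_mul (T : TAlgebra r A) {i j : Fin r} {a : A} (ha : a ∈ T.grade i j)
    (h : ∀ d ∈ T.grade j i, T.tr (a * d) = 0) : a = 0 :=
  (T.tr_mul_star_eq_zero a).1 (h _ (T.star_mem ha))

/-! ### Associativity -/

/-- The triple products of blocks in positions `(i, j)`, `(j, k)`, `(k, l)` associate. -/
def Assoc (T : TAlgebra r A) (i j k l : Fin r) : Prop :=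
  ∀ a b c, a ∈ T.grade i j → b ∈ T.grade j k → c ∈ T.grade k l → (a * b) * c = a * (b * c)

/-- The trace of the associator of `a, b, c` against `d` changes only its sign under cyclic shifts
of the four elements. -/
theorem Assoc.cyclic {T : TAlgebra r A} {i j k l : Fin r} (h : T.Assoc i j k l) :
    T.Assoc j k l i := by
  intro b c d hb hc hd
  rw [← sub_eq_zero]
  refine T.eq_zero_of_mem_of_tr_mul (Submodule.sub_mem _
    (T.mul_mem (T.mul_mem hb hc) hd) (T.mul_mem hb (T.mul_mem hc hd))) fun a ha => ?_
  rw [sub_mul, map_sub, sub_eq_zero]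
  calc T.tr ((b * c) * d * a) = T.tr (a * (b * c) * d) := by
        rw [T.tr_mul_comm, T.tr_mul_assoc a]
    _ = T.tr ((a * b) * c * d) := by rw [h a b c ha hb hc]
    _ = T.tr (b * (c * d) * a) := by
        rw [T.tr_mul_assoc, T.tr_mul_assoc, T.tr_mul_comm]

/-- The involution reverses the order of the indices. -/
theorem Assoc.reflect {T : TAlgebra r A} {i j k l : Fin r} (h : T.Assoc i j k l) :
    T.Assoc l k j i := by
  intro a b c ha hb hc
  have := congrArg star (h (star c) (star b) (star a) (T.star_mem hc) (T.star_mem hb)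
    (T.star_mem ha))
  simpa only [star_mul, star_star] using this.symm

theorem assoc_of_le (T : TAlgebra r A) {i j k l : Fin r} (h1 : i ≤ j) (h2 : j ≤ k) (h3 : l ≤ k) :
    T.Assoc i j k l := by
  intro a b c ha hb hc
  have := T.mul_assoc_star i j k l a b (star c) h1 h2 h3 ha hb (T.star_mem hc)
  rw [star_star] at this
  exact this.symm

/-- The associativity axioms cover all quadruples, up to cyclic shifts and reflections, in which
the pairs of opposite indices are not strictly separated. -/
theorem assoc_of_not_separated (T : TAlgebra r A) {i j k l : Fin r}
    (h1 : ¬ max j l < min i k) (h2 : ¬ max i k < min j l) : T.Assoc i j k l := by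
  have h : (i ≤ j ∧ j ≤ k ∧ l ≤ k) ∨ (j ≤ k ∧ k ≤ l ∧ i ≤ l) ∨ (k ≤ l ∧ l ≤ i ∧ j ≤ i) ∨
      (l ≤ i ∧ i ≤ j ∧ k ≤ j) ∨ (l ≤ k ∧ k ≤ j ∧ i ≤ j) ∨ (k ≤ j ∧ j ≤ i ∧ l ≤ i) ∨
      (j ≤ i ∧ i ≤ l ∧ k ≤ l) ∨ (i ≤ l ∧ l ≤ k ∧ j ≤ k) := by
    simp only [lt_min_iff, max_lt_iff] at h1 h2
    omega
  rcases h with h | h | h | h | h | h | h | h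
  · exact T.assoc_of_le h.1 h.2.1 h.2.2
  · exact (T.assoc_of_le h.1 h.2.1 h.2.2).cyclic.cyclic.cyclic
  · exact (T.assoc_of_le h.1 h.2.1 h.2.2).cyclic.cyclic
  · exact (T.assoc_of_le h.1 h.2.1 h.2.2).cyclic
  · exact (T.assoc_of_le h.1 h.2.1 h.2.2).reflect
  · exact (T.assoc_of_le h.1 h.2.1 h.2.2).cyclic.cyclic.cyclic.reflect
  · exact (T.assoc_of_le h.1 h.2.1 h.2.2).cyclic.cyclic.reflect
  · exact (T.assoc_of_le h.1 h.2.1 h.2.2).cyclic.reflect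

theorem mul_assoc_of (T : TAlgebra r A) {a b c : A}
    (h : ∀ i j k l, T.Assoc i j k l ∨ T.cp i j a = 0 ∨ T.cp j k b = 0 ∨ T.cp k l c = 0) :
    (a * b) * c = a * (b * c) := by
  refine T.ext_cp fun i l => ?_
  simp only [T.cp_mul, Finset.sum_mul, Finset.mul_sum]
  rw [Finset.sum_comm]
  refine Finset.sum_congr rfl fun j _ => Finset.sum_congr rfl fun k _ => ?_
  rcases h i j k l with h | h | h | h
  · exact h _ _ _ (T.cp_mem _ _ _) (T.cp_mem _ _ _) (T.cp_mem _ _ _)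
  all_goals simp [h]

/-- The lower triangular elements. -/
noncomputable def lower (T : TAlgebra r A) : Submodule ℝ A :=
  ⨅ (i : Fin r) (j : Fin r) (_ : i < j), LinearMap.ker (T.cp i j)

theorem mem_lower (T : TAlgebra r A) {a : A} : a ∈ T.lower ↔ ∀ i j, i < j → T.cp i j a = 0 := by
  simp [lower, Submodule.mem_iInf]

theorem lower_or (T : TAlgebra r A) {a : A} (ha : a ∈ T.lower) (i j : Fin r) :
    j ≤ i ∨ T.cp i j a = 0 := by
  rcases le_or_gt j i with h | h
  · exact Or.inl h
  · exact Or.inr (T.mem_lower.1 ha i j h)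

theorem upper_or (T : TAlgebra r A) {a : A} (ha : star a ∈ T.lower) (i j : Fin r) :
    i ≤ j ∨ T.cp i j a = 0 := by
  rcases T.lower_or ha j i with h | h
  · exact Or.inl h
  · rw [T.cp_star, star_eq_zero] at h
    exact Or.inr h

theorem mul_assoc_lower (T : TAlgebra r A) {a b : A} (ha : a ∈ T.lower) (hb : b ∈ T.lower)
    (c : A) : (a * b) * c = a * (b * c) := by
  refine T.mul_assoc_of fun i j k l => ?_
  rcases T.lower_or ha i j with h1 | h1
  · rcases T.lower_or hb j k with h2 | h2
    · refine Or.inl (T.assoc_of_not_separated ?_ ?_) <;> simp only [lt_min_iff, max_lt_iff] <;> omega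
    · simp [h2]
  · simp [h1]

theorem mul_assoc_upper_left (T : TAlgebra r A) {a b : A} (ha : star a ∈ T.lower)
    (hb : star b ∈ T.lower) (c : A) : (a * b) * c = a * (b * c) := by
  refine T.mul_assoc_of fun i j k l => ?_
  rcases T.upper_or ha i j with h1 | h1
  · rcases T.upper_or hb j k with h2 | h2
    · refine Or.inl (T.assoc_of_not_separated ?_ ?_) <;> simp only [lt_min_iff, max_lt_iff] <;> omega
    · simp [h2]
  · simp [h1]

theorem mul_assoc_upper_right (T : TAlgebra r A) (a : A) {b c : A} (hb : star b ∈ T.lower)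
    (hc : star c ∈ T.lower) : (a * b) * c = a * (b * c) := by
  have := congrArg star (T.mul_assoc_lower hc hb (star a))
  simpa only [star_mul, star_star] using this.symm

theorem mul_assoc_lower_right (T : TAlgebra r A) (a : A) {b c : A} (hb : b ∈ T.lower)
    (hc : c ∈ T.lower) : (a * b) * c = a * (b * c) := by
  have := congrArg star (T.mul_assoc_upper_left (a := star c) (b := star b) (by simpa) (by simpa)
    (star a))
  simpa only [star_mul, star_star] using this.symm

theorem mul_assoc_lower_upper (T : TAlgebra r A) {a c : A} (ha : a ∈ T.lower) (b : A)
    (hc : star c ∈ T.lower) : (a * b) * c = a * (b * c) := by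
  refine T.mul_assoc_of fun i j k l => ?_
  rcases T.lower_or ha i j with h1 | h1
  · rcases T.upper_or hc k l with h2 | h2
    · refine Or.inl (T.assoc_of_not_separated ?_ ?_) <;> simp only [lt_min_iff, max_lt_iff] <;> omega
    · simp [h2]
  · simp [h1]

theorem lower_mul (T : TAlgebra r A) {a b : A} (ha : a ∈ T.lower) (hb : b ∈ T.lower) :
    a * b ∈ T.lower := by
  rw [mem_lower]
  intro i j hij
  rw [T.cp_mul]
  refine Finset.sum_eq_zero fun k _ => ?_
  rcases T.lower_or ha i k with h1 | h1
  · rcases T.lower_or hb k j with h2 | h2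
    · omega
    · simp [h2]
  · simp [h1]

end TAlgebra

namespace TAlgebra

variable {r : ℕ} {A : Type*} [NonUnitalNonAssocRing A] [StarRing A] [Module ℝ A]

/-! ### The group of lower triangular elements with positive diagonal -/

theorem mem_LTpp (T : TAlgebra r A) {a : A} :
    a ∈ T.LTpp ↔ a ∈ T.lower ∧ ∀ i, 0 < T.diag i a := by
  simp only [LTpp, Set.mem_ofPred_eq, mem_lower, T.comp_eq_zero_iff]

theorem mem_LTp (T : TAlgebra r A) {a : A} :
    a ∈ T.LTp ↔ a ∈ T.lower ∧ ∀ i, 0 ≤ T.diag i a := by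
  simp only [LTp, Set.mem_ofPred_eq, mem_lower, T.comp_eq_zero_iff]

theorem isProperLT_iff (T : TAlgebra r A) {a : A} :
    T.IsProperLT a ↔ a ∈ T.lower ∧ (∀ i, 0 ≤ T.diag i a) ∧
      ∀ i, T.diag i a = 0 → ∀ k, T.cp k i a = 0 := by
  simp only [IsProperLT, mem_LTp, T.comp_eq_zero_iff, and_assoc]

theorem star_mem_lower (T : TAlgebra r A) {a : A} :
    star a ∈ T.lower ↔ ∀ i j, j < i → T.cp i j a = 0 := by
  simp only [mem_lower, T.cp_star, star_eq_zero]
  exact forall_comm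

/-- The idempotent `∑ i ∈ J, e_i`. -/
noncomputable def idem (T : TAlgebra r A) (J : Finset (Fin r)) : A := ∑ i ∈ J, T.e i

theorem cp_idem (T : TAlgebra r A) (J : Finset (Fin r)) (i j : Fin r) :
    T.cp i j (T.idem J) = if i = j ∧ i ∈ J then T.e i else 0 := by
  simp only [idem, map_sum, T.cp_e]
  by_cases h : i = j
  · subst h
    simp
  · simp only [h, false_and, if_false]
    refine Finset.sum_eq_zero fun k _ => if_neg ?_
    rintro ⟨rfl, rfl⟩
    exact h rfl

theorem idem_mem_lower (T : TAlgebra r A) (J : Finset (Fin r)) : T.idem J ∈ T.lower := by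
  rw [mem_lower]
  intro i j hij
  rw [cp_idem, if_neg]
  exact fun h => hij.ne h.1

theorem diag_idem (T : TAlgebra r A) (J : Finset (Fin r)) (i : Fin r) :
    T.diag i (T.idem J) = if i ∈ J then 1 else 0 := by
  rw [← T.diag_cp, cp_idem]
  by_cases h : i ∈ J <;> simp [h, T.diag_e]

theorem cp_idem_mul (T : TAlgebra r A) (J : Finset (Fin r)) (i j : Fin r) (a : A) :
    T.cp i j (T.idem J * a) = if i ∈ J then T.cp i j a else 0 := by
  rw [T.cp_mul, Finset.sum_eq_single i]
  · rw [cp_idem]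
    by_cases h : i ∈ J <;> simp [h, T.e_mul i j _ (T.cp_mem i j a)]
  · intro k _ hk
    rw [cp_idem, if_neg (fun h => hk h.1.symm), zero_mul]
  · simp

theorem cp_mul_idem (T : TAlgebra r A) (J : Finset (Fin r)) (i j : Fin r) (a : A) :
    T.cp i j (a * T.idem J) = if j ∈ J then T.cp i j a else 0 := by
  rw [T.cp_mul, Finset.sum_eq_single j]
  · rw [cp_idem]
    by_cases h : j ∈ J <;> simp [h, T.mul_e j i _ (T.cp_mem i j a)]
  · intro k _ hk
    rw [cp_idem, if_neg (fun h => hk h.1), mul_zero]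
  · simp

/-- The unit element `∑ i, e_i`. -/
noncomputable def unit (T : TAlgebra r A) : A := T.idem Finset.univ

theorem unit_mul (T : TAlgebra r A) (a : A) : T.unit * a = a :=
  T.ext_cp fun i j => by simp [unit, cp_idem_mul]

theorem mul_unit (T : TAlgebra r A) (a : A) : a * T.unit = a :=
  T.ext_cp fun i j => by simp [unit, cp_mul_idem]

theorem idem_mul_idem (T : TAlgebra r A) (J : Finset (Fin r)) :
    T.idem J * T.idem J = T.idem J :=
  T.ext_cp fun i j => by
    rw [cp_idem_mul, cp_idem]
    by_cases h : i ∈ J <;> simp [h]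

theorem idem_add_compl (T : TAlgebra r A) (J : Finset (Fin r)) :
    T.idem J + T.idem Jᶜ = T.unit := by
  simp only [idem, unit]
  exact Finset.sum_add_sum_compl _ _

theorem unit_mem_lower (T : TAlgebra r A) : T.unit ∈ T.lower := T.idem_mem_lower _

theorem unit_mem_LTpp (T : TAlgebra r A) : T.unit ∈ T.LTpp :=
  T.mem_LTpp.2 ⟨T.idem_mem_lower _, fun i => by simp [unit, diag_idem]⟩

variable [IsScalarTower ℝ A A] [SMulCommClass ℝ A A]

theorem diag_cp_mul_cp (T : TAlgebra r A) (i : Fin r) (a b : A) :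
    T.diag i (T.cp i i a * T.cp i i b) = T.diag i a * T.diag i b := by
  rw [T.cp_self, T.cp_self, smul_mul_assoc, mul_smul_comm, T.e_mul_e]
  simp [T.diag_e]

theorem cp_self_mul (T : TAlgebra r A) (i j : Fin r) (a b : A) :
    T.cp i i a * T.cp i j b = T.diag i a • T.cp i j b := by
  rw [T.cp_self, smul_mul_assoc, T.e_mul i j _ (T.cp_mem i j b)]

theorem mul_cp_self (T : TAlgebra r A) (i j : Fin r) (a b : A) :
    T.cp i j a * T.cp j j b = T.diag j b • T.cp i j a := by
  rw [T.cp_self, mul_smul_comm, T.mul_e j i _ (T.cp_mem i j a)]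

theorem diag_mul (T : TAlgebra r A) {a b : A} (ha : a ∈ T.lower) (hb : b ∈ T.lower)
    (i : Fin r) : T.diag i (a * b) = T.diag i a * T.diag i b := by
  rw [← T.diag_cp i (a * b), T.cp_mul, map_sum, Finset.sum_eq_single i]
  · exact T.diag_cp_mul_cp i a b
  · intro k _ hk
    rcases T.lower_or ha i k with h1 | h1
    · rcases T.lower_or hb k i with h2 | h2
      · omega
      · simp [h2]
    · simp [h1]
  · simp

theorem LTpp_mul (T : TAlgebra r A) {a b : A} (ha : a ∈ T.LTpp) (hb : b ∈ T.LTpp) :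
    a * b ∈ T.LTpp := by
  rw [mem_LTpp] at *
  exact ⟨T.lower_mul ha.1 hb.1, fun i => by
    rw [T.diag_mul ha.1 hb.1]; exact mul_pos (ha.2 i) (hb.2 i)⟩

theorem eq_zero_of_LTpp_mul_eq_zero (T : TAlgebra r A) {l x : A} (hl : l ∈ T.LTpp)
    (h : l * x = 0) : x = 0 := by
  rw [mem_LTpp] at hl
  -- The rows of `x` vanish one after the other.
  have key : ∀ i k, T.cp i k x = 0 := by
    intro i
    induction i using WellFoundedLT.induction with
    | ind i ih =>
      intro k
      have h1 : T.cp i k (l * x) = 0 := by rw [h, map_zero]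
      rw [T.cp_mul, Finset.sum_eq_single i, T.cp_self_mul] at h1
      · exact (smul_eq_zero.1 h1).resolve_left (hl.2 i).ne'
      · intro j _ hj
        rcases T.lower_or hl.1 i j with h2 | h2
        · rw [ih j (lt_of_le_of_ne h2 hj), mul_zero]
        · rw [h2, zero_mul]
      · simp
  exact T.ext_cp fun i k => by rw [key, map_zero]

/-- Left multiplication by `l` is injective on the lower triangular elements, hence surjective. -/
theorem exists_right_inv [FiniteDimensional ℝ A] (T : TAlgebra r A) {l : A} (hl : l ∈ T.LTpp) :
    ∃ m ∈ T.LTpp, l * m = T.unit := by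
  have hl' := T.mem_LTpp.1 hl
  let L : T.lower →ₗ[ℝ] T.lower :=
    (LinearMap.mulLeft ℝ l).restrict fun x hx => T.lower_mul hl'.1 hx
  have hinj : Function.Injective L := by
    rw [← LinearMap.ker_eq_bot, LinearMap.ker_eq_bot']
    intro x hx
    exact Subtype.ext (T.eq_zero_of_LTpp_mul_eq_zero hl (congrArg Subtype.val hx))
  obtain ⟨m, hm⟩ := (LinearMap.injective_iff_surjective.1 hinj)
    ⟨T.unit, (T.mem_LTpp.1 T.unit_mem_LTpp).1⟩
  have hm' : l * (m : A) = T.unit := congrArg Subtype.val hm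
  refine ⟨m, T.mem_LTpp.2 ⟨m.2, fun i => ?_⟩, hm'⟩
  have := congrArg (T.diag i) hm'
  rw [T.diag_mul hl'.1 m.2] at this
  have h1 : 0 < T.diag i l * T.diag i m := by
    rw [this]; exact (T.mem_LTpp.1 T.unit_mem_LTpp).2 i
  exact pos_of_mul_pos_right h1 (hl'.2 i).le

theorem exists_inv [FiniteDimensional ℝ A] (T : TAlgebra r A) {l : A} (hl : l ∈ T.LTpp) :
    ∃ m ∈ T.LTpp, l * m = T.unit ∧ m * l = T.unit := by
  obtain ⟨m, hm, h1⟩ := T.exists_right_inv hl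
  obtain ⟨n, hn, h2⟩ := T.exists_right_inv hm
  refine ⟨m, hm, h1, ?_⟩
  have : l = n := by
    have := T.mul_assoc_lower (T.mem_LTpp.1 hl).1 (T.mem_LTpp.1 hm).1 n
    rwa [h1, h2, unit_mul, mul_unit, eq_comm] at this
  rw [this, h2]

/-! ### Squared norms -/

variable [StarModule ℝ A]

theorem star_e (T : TAlgebra r A) (i : Fin r) : star (T.e i) = T.e i := by
  have h1 : star (T.e i) = T.diag i (star (T.e i)) • T.e i := by
    rw [← T.cp_self, T.cp_of_mem (T.star_mem (T.e_mem i))]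
  set c := T.diag i (star (T.e i))
  have h2 : c • T.e i = (c * c) • T.e i := by
    have := congrArg star (T.e_mul_e i)
    rw [star_mul, h1, smul_mul_assoc, mul_smul_comm, T.e_mul_e, smul_smul] at this
    exact this.symm
  have h3 : c = c * c := smul_left_injective ℝ (T.e_ne_zero i) h2
  have h4 : c ≠ 0 := by
    intro h
    rw [h, zero_smul, star_eq_zero] at h1
    exact T.e_ne_zero i h1
  have h5 : c = 1 := by
    have : c * (c - 1) = 0 := by linear_combination -h3
    rcases mul_eq_zero.1 this with h | h
    · exact absurd h h4
    · linarith
  rw [h1, h5, one_smul]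

theorem star_idem (T : TAlgebra r A) (J : Finset (Fin r)) : star (T.idem J) = T.idem J := by
  simp [idem, star_sum, T.star_e]

theorem star_unit (T : TAlgebra r A) : star T.unit = T.unit := T.star_idem _

theorem star_cp_self (T : TAlgebra r A) (i : Fin r) (a : A) :
    star (T.cp i i a) = T.cp i i a := by
  rw [T.cp_self, star_smul, star_trivial, T.star_e]

theorem diag_star (T : TAlgebra r A) (i : Fin r) (a : A) : T.diag i (star a) = T.diag i a :=
  T.diag_congr (by rw [T.cp_star, T.star_cp_self])

theorem tr_star (T : TAlgebra r A) (a : A) : T.tr (star a) = T.tr a := by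
  simp only [T.tr_apply, T.diag_star]

theorem mul_star_of_mem (T : TAlgebra r A) {i j : Fin r} {a : A} (ha : a ∈ T.grade i j) :
    a * star a = T.tr (a * star a) • T.e i := by
  have h := T.mul_mem ha (T.star_mem ha)
  rw [T.tr_of_mem h, ← T.cp_self, T.cp_of_mem h]

theorem diag_mul_star (T : TAlgebra r A) (i : Fin r) (t : A) :
    T.diag i (t * star t) = ∑ k, T.tr (T.cp i k t * star (T.cp i k t)) := by
  rw [← T.diag_cp, T.cp_mul_star, map_sum]
  refine Finset.sum_congr rfl fun k _ => ?_
  rw [T.tr_of_mem (T.mul_mem (T.cp_mem i k t) (T.star_mem (T.cp_mem i k t)))]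

theorem diag_mul_star_nonneg (T : TAlgebra r A) (i : Fin r) (t : A) :
    0 ≤ T.diag i (t * star t) := by
  rw [diag_mul_star]
  exact Finset.sum_nonneg fun k _ => T.tr_mul_star_nonneg _

theorem cp_eq_zero_of_diag_mul_star (T : TAlgebra r A) {i : Fin r} {t : A}
    (h : T.diag i (t * star t) = 0) (k : Fin r) : T.cp i k t = 0 := by
  rw [diag_mul_star, Finset.sum_eq_zero_iff_of_nonneg fun k _ => T.tr_mul_star_nonneg _] at h
  exact (T.tr_mul_star_eq_zero _).1 (h k (Finset.mem_univ k))

/-! ### Quadratic maps of lower triangular elements -/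

theorem star_coe (b : Herm A) : star (b : A) = b := b.2

/-- For lower triangular `l` the correction term `l (l b) - (l l) b` vanishes, and `l (b l^*)` is
already Hermitian. -/
theorem quadMap_coe (T : TAlgebra r A) {l : A} (hl : l ∈ T.lower) (b : Herm A) :
    (quadMap l b : A) = l * ((b : A) * star l) := by
  have h1 : l * (l * (b : A)) = (l * l) * (b : A) := (T.mul_assoc_lower hl hl _).symm
  have h2 : star (l * ((b : A) * star l)) = l * ((b : A) * star l) := by
    rw [star_mul, star_mul, star_star, star_coe]
    exact T.mul_assoc_lower_upper hl _ (by rwa [star_star])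
  change (1 / 2 : ℝ) • (_ + star _) = _
  rw [h1, add_sub_cancel_right, h2, ← two_smul ℝ, smul_smul]
  norm_num

theorem coe_mulStar (t : A) : (mulStar t : A) = t * star t := rfl

theorem quadMap_mulStar (T : TAlgebra r A) {l t : A} (hl : l ∈ T.lower) (ht : t ∈ T.lower) :
    quadMap l (mulStar t) = mulStar (l * t) := by
  apply Subtype.ext
  rw [T.quadMap_coe hl, coe_mulStar, coe_mulStar, star_mul,
    T.mul_assoc_upper_right t (by rwa [star_star]) (by rwa [star_star]),
    T.mul_assoc_lower hl ht]

theorem quadMap_quadMap (T : TAlgebra r A) {l m : A} (hl : l ∈ T.lower) (hm : m ∈ T.lower)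
    (b : Herm A) : quadMap l (quadMap m b) = quadMap (l * m) b := by
  apply Subtype.ext
  rw [T.quadMap_coe hl, T.quadMap_coe hm, T.quadMap_coe (T.lower_mul hl hm), star_mul,
    T.mul_assoc_lower hl hm, T.mul_assoc_lower_upper hm _ (by rwa [star_star]),
    T.mul_assoc_upper_right _ (by rwa [star_star]) (by rwa [star_star])]

theorem quadMap_unit (T : TAlgebra r A) (b : Herm A) : quadMap T.unit b = b := by
  apply Subtype.ext
  rw [T.quadMap_coe T.unit_mem_lower, star_unit, unit_mul, mul_unit]

/-- The diagonal Hermitian element `∑ i ∈ J, e_i`. -/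
noncomputable def hermIdem (T : TAlgebra r A) (J : Finset (Fin r)) : Herm A := mulStar (T.idem J)

theorem coe_hermIdem (T : TAlgebra r A) (J : Finset (Fin r)) : (T.hermIdem J : A) = T.idem J := by
  rw [hermIdem, coe_mulStar, star_idem, idem_mul_idem]

theorem inner_apply (T : TAlgebra r A) (x y : Herm A) : T.inner x y = T.tr ((x : A) * (y : A)) := by
  rw [inner, LinearMap.mk₂_apply, star_coe]

/-- The adjoint of `Q_l` is `Q_{l^*}`, on the elements `u u^*`. -/
theorem inner_quadMap (T : TAlgebra r A) {l u : A} (hl : l ∈ T.lower) (hu : star u ∈ T.lower)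
    (y : Herm A) : T.inner (mulStar u) (quadMap l y) = T.inner (mulStar (star l * u)) y := by
  have hl' : star (star l) ∈ T.lower := by rwa [star_star]
  rw [inner_apply, inner_apply, T.quadMap_coe hl, coe_mulStar, coe_mulStar, star_mul, star_star,
    ← T.tr_mul_assoc (u * star u), ← T.tr_mul_assoc, T.tr_mul_comm _ (star l), ← T.tr_mul_assoc,
    T.mul_assoc_lower_right u hu hl, T.mul_assoc_upper_left hl' hu]

end TAlgebra

/-! ### Triangular factorization in the dual cone -/

theorem nonneg_of_forall_quadratic_nonneg {a b c : ℝ}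
    (h : ∀ ε : ℝ, 0 < ε → 0 ≤ a + ε * b + ε ^ 2 * c) : 0 ≤ a := by
  have hc : Continuous fun ε : ℝ => a + ε * b + ε ^ 2 * c := by fun_prop
  have h1 : Filter.Tendsto (fun ε : ℝ => a + ε * b + ε ^ 2 * c) (nhdsWithin 0 (Set.Ioi 0))
      (nhds a) := by
    have := (hc.tendsto 0).mono_left (nhdsWithin_le_nhds (s := Set.Ioi 0))
    simpa using this
  refine ge_of_tendsto h1 ?_
  filter_upwards [self_mem_nhdsWithin] with ε hε using h ε hε

namespace TAlgebra

variable {r : ℕ} {A : Type*} [NonUnitalNonAssocRing A] [StarRing A] [Module ℝ A]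

variable [IsScalarTower ℝ A A] [SMulCommClass ℝ A A] [StarModule ℝ A]

theorem mem_UTpp (T : TAlgebra r A) {a : A} :
    a ∈ T.UTpp ↔ star a ∈ T.lower ∧ ∀ i, 0 < T.diag i a := by
  simp only [UTpp, Set.mem_ofPred_eq, star_mem_lower, T.comp_eq_zero_iff]

theorem LTpp_subset_LTp (T : TAlgebra r A) {a : A} (ha : a ∈ T.LTpp) : a ∈ T.LTp :=
  T.mem_LTp.2 ⟨(T.mem_LTpp.1 ha).1, fun i => ((T.mem_LTpp.1 ha).2 i).le⟩

theorem idem_mem_LTp (T : TAlgebra r A) (J : Finset (Fin r)) : T.idem J ∈ T.LTp :=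
  T.mem_LTp.2 ⟨T.idem_mem_lower J, fun i => by rw [diag_idem]; split_ifs <;> norm_num⟩

theorem mem_dualCone (T : TAlgebra r A) {y : Herm A} :
    y ∈ T.dualCone ↔ ∀ u ∈ T.UTpp, 0 ≤ T.inner (mulStar u) y := by
  rw [dualCone, PointedCone.mem_dual]
  exact Set.forall_mem_image

/-- Positivity on `u u^*` extends to upper triangular `u` with nonnegative diagonal: replace `u` by
`u + ε` and let `ε` tend to zero. -/
theorem inner_nonneg (T : TAlgebra r A) {y : Herm A} (hy : y ∈ T.dualCone) {u : A}
    (hu : star u ∈ T.lower) (hd : ∀ i, 0 ≤ T.diag i u) : 0 ≤ T.inner (mulStar u) y := by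
  rw [mem_dualCone] at hy
  refine nonneg_of_forall_quadratic_nonneg (b := T.tr ((u + star u) * (y : A)))
    (c := T.tr (T.unit * (y : A))) fun ε hε => ?_
  have h1 : u + ε • T.unit ∈ T.UTpp := by
    refine T.mem_UTpp.2 ⟨?_, fun i => ?_⟩
    · rw [star_add, star_smul, star_unit]
      exact T.lower.add_mem hu (T.lower.smul_mem _ T.unit_mem_lower)
    · have := hd i
      rw [map_add, map_smul, unit, diag_idem]
      simp only [Finset.mem_univ, if_true, smul_eq_mul, mul_one]
      linarith
  refine (hy _ h1).trans (le_of_eq ?_)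
  rw [inner_apply, inner_apply, coe_mulStar, coe_mulStar, star_add, star_smul, star_unit,
    star_trivial ε]
  simp only [add_mul, mul_add, smul_mul_assoc, mul_smul_comm, unit_mul, mul_unit, map_add,
    map_smul, smul_eq_mul]
  ring

theorem quadMap_mem_dualCone (T : TAlgebra r A) {l : A} (hl : l ∈ T.LTp) {y : Herm A}
    (hy : y ∈ T.dualCone) : quadMap l y ∈ T.dualCone := by
  rw [mem_LTp] at hl
  rw [mem_dualCone]
  intro u hu
  rw [mem_UTpp] at hu
  rw [T.inner_quadMap hl.1 hu.1]
  have h : star (star l * u) = star u * l := by rw [star_mul, star_star]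
  refine T.inner_nonneg hy ?_ fun i => ?_
  · rw [h]
    exact T.lower_mul hu.1 hl.1
  · rw [← T.diag_star, h, T.diag_mul hu.1 hl.1, T.diag_star]
    exact mul_nonneg (hu.2 i).le (hl.2 i)

theorem inner_unit (T : TAlgebra r A) (u : A) :
    T.inner (mulStar u) (T.hermIdem Finset.univ) = T.tr (u * star u) := by
  rw [inner_apply, coe_hermIdem, coe_mulStar]
  exact congrArg T.tr (T.mul_unit _)

theorem mulStar_mem_dualCone (T : TAlgebra r A) {t : A} (ht : t ∈ T.lower) :
    mulStar t ∈ T.dualCone := by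
  rw [mem_dualCone]
  intro u hu
  have h : mulStar t = quadMap t (T.hermIdem Finset.univ) := by
    rw [hermIdem, T.quadMap_mulStar ht (T.idem_mem_lower _)]
    exact congrArg mulStar (T.mul_unit t).symm
  rw [h, T.inner_quadMap ht (T.mem_UTpp.1 hu).1, inner_unit]
  exact T.tr_mul_star_nonneg _

theorem hermIdem_mem_dualCone (T : TAlgebra r A) (J : Finset (Fin r)) :
    T.hermIdem J ∈ T.dualCone := T.mulStar_mem_dualCone (T.idem_mem_lower J)

theorem idem_singleton (T : TAlgebra r A) (i : Fin r) : T.idem {i} = T.e i := by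
  simp [idem]

theorem tr_e_mul (T : TAlgebra r A) (i : Fin r) (y : A) : T.tr (T.e i * y) = T.diag i y := by
  rw [T.tr_apply, Finset.sum_eq_single i]
  · refine T.diag_congr ?_
    rw [← idem_singleton, cp_idem_mul]
    simp
  · intro j _ hj
    refine T.diag_eq_zero_of_cp ?_
    rw [← idem_singleton, cp_idem_mul]
    simp [hj]
  · simp

theorem diag_nonneg (T : TAlgebra r A) {y : Herm A} (hy : y ∈ T.dualCone) (i : Fin r) :
    0 ≤ T.diag i (y : A) := by
  have := T.inner_nonneg hy (u := T.idem {i}) (by rw [star_idem]; exact T.idem_mem_lower _)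
    (T.mem_LTp.1 (T.idem_mem_LTp _)).2
  rwa [inner_apply, coe_mulStar, star_idem, idem_mul_idem, idem_singleton, tr_e_mul] at this

/-- A row of an element of the dual cone vanishes to the right of a vanishing diagonal entry:
test against `u u^*`, where `u = -y_nk + β e_k` and `β` tends to zero. -/
theorem cp_eq_zero_of_diag (T : TAlgebra r A) {y : Herm A} (hy : y ∈ T.dualCone) {n k : Fin r}
    (hn : T.diag n (y : A) = 0) (hk : n < k) : T.cp n k (y : A) = 0 := by
  set v : A := -T.cp n k (y : A) with hv
  have hvm : v ∈ T.grade n k := Submodule.neg_mem _ (T.cp_mem _ _ _)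
  obtain ⟨c, hc⟩ : ∃ c : ℝ, v * star v = c • T.e n := ⟨_, T.mul_star_of_mem hvm⟩
  have key : ∀ β : ℝ, 0 < β →
      0 ≤ β * T.tr ((v + star v) * (y : A)) + β ^ 2 * T.diag k (y : A) := by
    intro β hβ
    have h := T.inner_nonneg hy (u := v + β • T.e k) (by
      rw [star_mem_lower]
      intro i j hij
      rw [map_add, map_smul, T.cp_e, if_neg (by rintro ⟨rfl, rfl⟩; exact hij.ne rfl),
        T.cp_of_mem_ne hvm, smul_zero, add_zero]
      intro h
      simp only [Prod.mk.injEq] at h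
      obtain ⟨rfl, rfl⟩ := h
      exact lt_asymm hij hk) (fun i => by
      rw [map_add, map_smul, T.diag_of_mem_ne hvm, zero_add, smul_eq_mul]
      · refine mul_nonneg hβ.le ?_
        rw [← idem_singleton, diag_idem]
        split_ifs <;> norm_num
      · intro h
        simp only [Prod.mk.injEq] at h
        exact hk.ne (h.1.trans h.2.symm))
    refine h.trans (le_of_eq ?_)
    rw [inner_apply, coe_mulStar, star_add, star_smul, star_e, star_trivial β]
    simp only [add_mul, mul_add, smul_mul_assoc, mul_smul_comm, hc,
      T.mul_e k n v hvm, T.e_mul k n _ (T.star_mem hvm), T.e_mul_e, map_add, map_smul,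
      tr_e_mul, hn, smul_eq_mul]
    ring
  have h1 : 0 ≤ T.tr ((v + star v) * (y : A)) := by
    refine nonneg_of_forall_quadratic_nonneg (b := T.diag k (y : A)) (c := 0) fun β hβ => ?_
    have h2 := key β hβ
    have h3 : β * T.tr ((v + star v) * (y : A)) + β ^ 2 * T.diag k (y : A) =
        β * (T.tr ((v + star v) * (y : A)) + β * T.diag k (y : A) + β ^ 2 * 0) := by ring
    rw [h3] at h2
    exact nonneg_of_mul_nonneg_right h2 hβ
  have h2 : T.tr (star v * (y : A)) = T.tr (v * (y : A)) := by
    rw [← T.tr_star, star_mul, star_star, star_coe, T.tr_mul_comm]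
  have h3 : T.tr (v * (y : A)) = -T.tr (T.cp n k (y : A) * star (T.cp n k (y : A))) := by
    rw [tr_eq_sum_cp, Finset.sum_eq_single n, Finset.sum_eq_single k, T.cp_of_mem hvm, hv,
      ← T.cp_star, star_coe, neg_mul, map_neg]
    · intro j _ hj
      rw [T.cp_of_mem_ne hvm, zero_mul, map_zero]
      exact fun h => hj (congrArg Prod.snd h).symm
    · simp
    · intro i _ hi
      refine Finset.sum_eq_zero fun j _ => ?_
      rw [T.cp_of_mem_ne hvm, zero_mul, map_zero]
      exact fun h => hi (congrArg Prod.fst h).symm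
    · simp
  rw [add_mul, map_add, h2, h3] at h1
  have h4 := T.tr_mul_star_nonneg (T.cp n k (y : A))
  exact (T.tr_mul_star_eq_zero _).1 (by linarith)

theorem isProperLT_mul (T : TAlgebra r A) {l t : A} (hl : l ∈ T.LTpp) (ht : T.IsProperLT t) :
    T.IsProperLT (l * t) := by
  rw [mem_LTpp] at hl
  rw [isProperLT_iff] at *
  refine ⟨T.lower_mul hl.1 ht.1, fun i => ?_, fun i hi k => ?_⟩
  · rw [T.diag_mul hl.1 ht.1]
    exact mul_nonneg (hl.2 i).le (ht.2.1 i)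
  · rw [T.diag_mul hl.1 ht.1] at hi
    have h := (mul_eq_zero.1 hi).resolve_left (hl.2 i).ne'
    rw [T.cp_mul]
    exact Finset.sum_eq_zero fun j _ => by rw [ht.2.2 i h, mul_zero]

theorem IsProperLT.cp_eq_zero {T : TAlgebra r A} {t : A} (ht : T.IsProperLT t) {i : Fin r}
    (h : T.diag i (t * star t) = 0) (k : Fin r) : T.cp i k t = 0 ∧ T.cp k i t = 0 := by
  have h1 := T.cp_eq_zero_of_diag_mul_star h
  exact ⟨h1 k, (T.isProperLT_iff.1 ht).2.2 i (T.diag_eq_zero_of_cp (h1 i)) k⟩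

/-- The columns of a proper factor are determined one after the other. -/
theorem IsProperLT.unique {T : TAlgebra r A} {t s : A} (ht : T.IsProperLT t)
    (hs : T.IsProperLT s) (h : (mulStar t : Herm A) = mulStar s) : t = s := by
  have h' : t * star t = s * star s := congrArg Subtype.val h
  rw [isProperLT_iff] at ht hs
  have key : ∀ i k, T.cp k i t = T.cp k i s := by
    intro i
    induction i using WellFoundedLT.induction with
    | ind i ih =>
      have h1 : ∀ k, T.diag i t • T.cp k i t = T.diag i s • T.cp k i s := by
        intro k
        have h2 : T.cp k i (t * star t) = T.cp k i (s * star s) := by rw [h']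
        rw [T.cp_mul_star, T.cp_mul_star, ← sub_eq_zero, ← Finset.sum_sub_distrib,
          Finset.sum_eq_single i, sub_eq_zero, T.star_cp_self, T.star_cp_self, T.mul_cp_self,
          T.mul_cp_self] at h2
        · exact h2
        · intro j _ hj
          rcases lt_or_gt_of_ne hj with hj | hj
          · rw [ih j hj, ih j hj, sub_self]
          · rw [T.mem_lower.1 ht.1 i j hj, T.mem_lower.1 hs.1 i j hj]
            simp
        · simp
      have h3 : T.diag i t = T.diag i s := by
        have h4 := congrArg (T.diag i) (h1 i)
        rw [map_smul, map_smul, T.diag_cp, T.diag_cp, smul_eq_mul, smul_eq_mul] at h4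
        nlinarith [ht.2.1 i, hs.2.1 i, mul_self_inj (ht.2.1 i) (hs.2.1 i)]
      intro k
      by_cases h5 : T.diag i t = 0
      · rw [ht.2.2 i h5, hs.2.2 i (h3 ▸ h5)]
      · have := h1 k
        rw [← h3] at this
        exact smul_right_injective A h5 this
  exact T.ext_cp fun i j => key j i

theorem coe_quadMap_idem_cp (T : TAlgebra r A) (J : Finset (Fin r)) (y : Herm A) (i j : Fin r) :
    T.cp i j (quadMap (T.idem J) y : A) = if i ∈ J ∧ j ∈ J then T.cp i j (y : A) else 0 := by
  rw [T.quadMap_coe (T.idem_mem_lower J), star_idem, cp_idem_mul, cp_mul_idem]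
  by_cases h1 : i ∈ J <;> simp [h1]

theorem cp_symm (T : TAlgebra r A) {y : Herm A} {i j : Fin r} (h : T.cp i j (y : A) = 0) :
    T.cp j i (y : A) = 0 := by
  rw [← star_coe y, T.cp_star, h, star_zero]

variable [FiniteDimensional ℝ A]

/-- One step of the elimination: a triangular automorphism clears the `n`-th row and column
off the diagonal, if all rows above vanish. -/
theorem exists_clear (T : TAlgebra r A) (y : Herm A) {n : Fin r}
    (hrow : ∀ i < n, ∀ k, T.cp i k (y : A) = 0) (hd : T.diag n (y : A) ≠ 0) :
    ∃ l ∈ T.LTpp, (∀ i < n, ∀ k, T.cp i k (quadMap l y : A) = 0) ∧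
      T.diag n (quadMap l y : A) = T.diag n (y : A) ∧
      ∀ k, k ≠ n → T.cp n k (quadMap l y : A) = 0 := by
  set d := T.diag n (y : A) with hdd
  -- `l` subtracts the multiple `y_kn y_nn⁻¹` of row `n` from each row `k > n`.
  set c : A := ∑ k ∈ Finset.Ioi n, T.cp k n (y : A) with hc
  have hcc : ∀ i j, T.cp i j c = if n < i ∧ j = n then T.cp i n (y : A) else 0 := by
    intro i j
    simp only [hc, map_sum, T.cp_cp]
    by_cases hj : j = n
    · subst hj
      simp
    · simp [hj]
  set l : A := T.unit - d⁻¹ • c with hl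
  have hlc : ∀ i j, T.cp i j l = (if i = j then T.e i else 0) -
      d⁻¹ • (if n < i ∧ j = n then T.cp i n (y : A) else 0) := by
    intro i j
    rw [hl, map_sub, map_smul, hcc, unit, cp_idem]
    simp
  have hlow : l ∈ T.lower := by
    rw [mem_lower]
    intro i j hij
    rw [hlc, if_neg hij.ne, if_neg (by rintro ⟨h, rfl⟩; exact lt_asymm h hij)]
    simp
  have hll : l ∈ T.LTpp := by
    refine T.mem_LTpp.2 ⟨hlow, fun i => ?_⟩
    have : T.diag i l = 1 := by
      rw [← T.diag_cp, hlc, if_pos rfl, if_neg (by rintro ⟨h, rfl⟩; exact lt_irrefl _ h)]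
      simp [T.diag_e]
    rw [this]; exact one_pos
  have hle : ∀ i ≤ n, ∀ j, T.cp i j l = if i = j then T.e i else 0 := by
    intro i hi j
    rw [hlc, if_neg (c := n < i ∧ j = n) (fun h => not_lt_of_ge hi h.1)]
    simp
  have hlz : ∀ (i) (_ : i ≤ n) (j) (w : A), T.cp i j (l * w) = T.cp i j w := by
    intro i hi j w
    rw [T.cp_mul, Finset.sum_eq_single i]
    · rw [hle i hi, if_pos rfl, T.e_mul i j _ (T.cp_mem _ _ _)]
    · intro k _ hk
      rw [hle i hi, if_neg hk.symm, zero_mul]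
    · simp
  have hcol : ∀ a, T.cp a n ((y : A) * star l) = T.cp a n (y : A) := by
    intro a
    rw [T.cp_mul_star, Finset.sum_eq_single n]
    · rw [hle n le_rfl, if_pos rfl, star_e, T.mul_e n a _ (T.cp_mem _ _ _)]
    · intro k _ hk
      rw [hle n le_rfl, if_neg hk.symm, star_zero, mul_zero]
    · simp
  have hz := T.quadMap_coe hlow y
  refine ⟨l, hll, fun i hi k => ?_, T.diag_congr ?_, fun k hk => T.cp_symm ?_⟩
  · rw [hz, hlz i hi.le, T.cp_mul]
    exact Finset.sum_eq_zero fun a _ => by rw [hrow i hi, zero_mul]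
  · rw [hz, hlz n le_rfl, hcol]
  · rw [hz]
    rcases lt_or_gt_of_ne hk with hk | hk
    · rw [hlz k hk.le, hcol, hrow k hk]
    · rw [T.cp_mul]
      simp only [hcol, hlc, hk, true_and, sub_mul, Finset.sum_sub_distrib, ite_mul, zero_mul,
        smul_ite, smul_zero, Finset.sum_ite_eq, Finset.sum_ite_eq', Finset.mem_univ, if_true]
      rw [T.e_mul k n _ (T.cp_mem _ _ _), smul_mul_assoc, T.mul_cp_self, smul_smul, ← hdd,
        inv_mul_cancel₀ hd, one_smul, sub_self]

/-- Triangular factorization of the elements of the dual cone all of whose rows vanish, except the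
last `m`. Row and column `n` of the remaining block are cleared by a triangular automorphism, the
lower right block is factorized by induction, and `√y_nn e_n` is added to its factor. -/
theorem exists_isProperLT_aux (T : TAlgebra r A) (m : ℕ) :
    ∀ y ∈ T.dualCone, (∀ i k : Fin r, (i : ℕ) + m < r → T.cp i k (y : A) = 0) →
      ∃ t, T.IsProperLT t ∧ mulStar t = y := by
  induction m with
  | zero =>
    intro y _ h
    refine ⟨0, T.isProperLT_iff.2 ⟨T.lower.zero_mem, by simp, by simp⟩, ?_⟩
    apply Subtype.ext
    rw [coe_mulStar, zero_mul]
    exact T.ext_cp fun i j => by rw [h i j (by simp), map_zero]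
  | succ m ih =>
    intro y hy h
    by_cases hm : r ≤ m
    · exact ih y hy fun i k hi => by omega
    let n : Fin r := ⟨r - 1 - m, by omega⟩
    have hrow : ∀ i < n, ∀ k, T.cp i k (y : A) = 0 := fun i hi k =>
      h i k (by have := Fin.lt_def.1 hi; simp only [n] at this; omega)
    have hle : ∀ i : Fin r, (i : ℕ) + m < r → i ≤ n := fun i hi =>
      Fin.le_def.2 (by simp only [n]; omega)
    by_cases hd : T.diag n (y : A) = 0
    · refine ih y hy fun i k hi => ?_
      rcases (hle i hi).lt_or_eq with hi | rfl
      · exact hrow i hi k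
      rcases lt_trichotomy n k with hk | hk | hk
      · exact T.cp_eq_zero_of_diag hy hd hk
      · rw [← hk, T.cp_self, hd, zero_smul]
      · exact T.cp_symm (hrow k hk n)
    obtain ⟨l, hl, h1, h2, h3⟩ := T.exists_clear y hrow hd
    set z := quadMap l y with hz
    have hzK : z ∈ T.dualCone := T.quadMap_mem_dualCone (T.LTpp_subset_LTp hl) hy
    set J := Finset.Ioi n
    -- The compression `z'` of `z` to the indices above `n` satisfies `z = z' + y_nn e_n`.
    set z' := quadMap (T.idem J) z with hz'
    have hz'K : z' ∈ T.dualCone := T.quadMap_mem_dualCone (T.idem_mem_LTp J) hzK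
    have hz'row : ∀ i ≤ n, ∀ k, T.cp i k (z' : A) = 0 := by
      intro i hi k
      rw [hz', coe_quadMap_idem_cp, if_neg]
      simp only [J, Finset.mem_Ioi, not_and]
      intro h; omega
    obtain ⟨t', ht', htz⟩ := ih z' hz'K fun i k hi => hz'row i (hle i hi) k
    -- As `t'` is proper, its column `n` vanishes too, so the cross terms with `e_n` are zero.
    have ht0 := ht'.cp_eq_zero (i := n) (by
      rw [← coe_mulStar, htz]
      exact T.diag_eq_zero_of_cp (hz'row n le_rfl n))
    set δ := Real.sqrt (T.diag n (y : A)) with hδ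
    have hpos : 0 < T.diag n (y : A) := lt_of_le_of_ne (T.diag_nonneg hy n) (Ne.symm hd)
    have hδpos : 0 < δ := Real.sqrt_pos.2 hpos
    have hte : t' * T.e n = 0 := T.ext_cp fun i j => by
      rw [← idem_singleton, cp_mul_idem, map_zero]
      split_ifs with hj
      · rw [Finset.mem_singleton.1 hj]
        exact (ht0 i).2
      · rfl
    have het : T.e n * star t' = 0 := by
      have := congrArg star hte
      rwa [star_mul, star_e, star_zero] at this
    have hproper : T.IsProperLT (t' + δ • T.e n) := by
      rw [isProperLT_iff] at ht' ⊢
      have he : ∀ i, T.diag i (T.e n) = if i = n then 1 else 0 := fun i => by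
        rw [← idem_singleton, diag_idem]; simp
      refine ⟨T.lower.add_mem ht'.1 (T.lower.smul_mem _ ?_), fun i => ?_, fun i hi k => ?_⟩
      · rw [← idem_singleton]
        exact T.idem_mem_lower _
      · rw [map_add, map_smul, he, smul_eq_mul]
        have := ht'.2.1 i
        split_ifs <;> nlinarith
      · rw [map_add, map_smul, he, smul_eq_mul] at hi
        have := ht'.2.1 i
        by_cases hin : i = n
        · rw [if_pos hin] at hi
          nlinarith
        · rw [if_neg hin, mul_zero, add_zero] at hi
          rw [map_add, map_smul, ht'.2.2 i hi, T.cp_e, if_neg (fun h => hin h.2)]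
          simp
    have hmul : mulStar (t' + δ • T.e n) = z := by
      apply Subtype.ext
      have h4 : ((mulStar (t' + δ • T.e n) : Herm A) : A) =
          (z' : A) + T.diag n (y : A) • T.e n := by
        rw [← htz, coe_mulStar, coe_mulStar, star_add, star_smul, star_e, star_trivial δ]
        simp only [add_mul, mul_add, smul_mul_assoc, mul_smul_comm, hte, het, T.e_mul_e,
          smul_zero, add_zero, zero_add, smul_smul]
        rw [hδ, Real.mul_self_sqrt hpos.le]
      rw [h4]
      have h5 : ∀ j, T.cp n j ((z' : A) + T.diag n (y : A) • T.e n) = T.cp n j (z : A) := by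
        intro j
        rw [map_add, map_smul, hz'row n le_rfl, zero_add, T.cp_e]
        by_cases hj : j = n
        · rw [hj, if_pos ⟨rfl, rfl⟩, T.cp_self, h2]
        · rw [if_neg (fun h => hj h.2), h3 j hj, smul_zero]
      refine T.ext_cp fun i j => ?_
      rcases lt_trichotomy i n with hi | rfl | hi
      · rw [map_add, map_smul, hz'row i hi.le, h1 i hi, T.cp_e, if_neg (fun h => hi.ne h.1)]
        simp
      · exact h5 j
      · rw [map_add, map_smul, T.cp_e, if_neg (fun h => hi.ne' h.1), smul_zero, add_zero, hz',
          coe_quadMap_idem_cp]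
        split_ifs with hJ
        · rfl
        · have hj : j ≤ n := by
            by_contra hj
            exact hJ ⟨Finset.mem_Ioi.2 hi, Finset.mem_Ioi.2 (not_le.1 hj)⟩
          rcases hj.lt_or_eq with hj | rfl
          · rw [T.cp_symm (h1 j hj i)]
          · rw [T.cp_symm (h3 i hi.ne')]
    obtain ⟨m, hm, hlm, hml⟩ := T.exists_inv hl
    refine ⟨m * (t' + δ • T.e n), T.isProperLT_mul hm hproper, ?_⟩
    rw [← T.quadMap_mulStar (T.mem_LTpp.1 hm).1 (T.isProperLT_iff.1 hproper).1, hmul, hz,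
      T.quadMap_quadMap (T.mem_LTpp.1 hm).1 (T.mem_LTpp.1 hl).1, hml, quadMap_unit]

/-- Every element of the dual cone has a proper lower triangular factor. -/
theorem exists_isProperLT (T : TAlgebra r A) {y : Herm A} (hy : y ∈ T.dualCone) :
    ∃ t, T.IsProperLT t ∧ mulStar t = y :=
  T.exists_isProperLT_aux r y hy fun i k hi => by omega

end TAlgebra

/-! ### Relative interiors and faces of convex cones -/

/-- `x` lies in the face of the cone `C` generated by `y`: a multiple of `x` can be subtracted
from `y` without leaving `C`. -/
def ConeDominated {E : Type*} [AddCommGroup E] [Module ℝ E] (C : Set E) (x y : E) : Prop :=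
  ∃ ε : ℝ, 0 < ε ∧ y - ε • x ∈ C

/-- The algebraic relative interior of a cone: the elements generating it as a face. -/
def coneCore {E : Type*} [AddCommGroup E] [Module ℝ E] (C : Set E) : Set E :=
  {x | x ∈ C ∧ ∀ y ∈ C, ConeDominated C y x}

section Cone

variable {E : Type*} [AddCommGroup E] [Module ℝ E]

theorem coneDominated_image_iff {E' : Type*} [AddCommGroup E'] [Module ℝ E'] (φ : E →ₗ[ℝ] E')
    (hφ : Function.Injective φ) (C : Set E) (x y : E) :
    ConeDominated (φ '' C) (φ x) (φ y) ↔ ConeDominated C x y := by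
  unfold ConeDominated
  refine exists_congr fun ε => and_congr_right fun _ => ?_
  rw [← map_smul, ← map_sub, hφ.mem_set_image]

theorem coneCore_image {E' : Type*} [AddCommGroup E'] [Module ℝ E'] (φ : E →ₗ[ℝ] E')
    (hφ : Function.Injective φ) (C : Set E) : coneCore (φ '' C) = φ '' coneCore C := by
  ext x
  constructor
  · rintro ⟨⟨x, hx, rfl⟩, h⟩
    refine ⟨x, ⟨hx, fun y hy => ?_⟩, rfl⟩
    exact (coneDominated_image_iff φ hφ C y x).1 (h _ ⟨y, hy, rfl⟩)
  · rintro ⟨x, ⟨hx, h⟩, rfl⟩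
    refine ⟨⟨x, hx, rfl⟩, ?_⟩
    rintro _ ⟨y, hy, rfl⟩
    exact (coneDominated_image_iff φ hφ C y x).2 (h y hy)

theorem PointedCone.real_smul_mem (C : PointedCone ℝ E) {c : ℝ} (hc : 0 ≤ c) {x : E}
    (hx : x ∈ C) : c • x ∈ C := C.smul_mem hc hx

/-- The span of a cone has a basis of elements of the cone, with coordinates defined on the
ambient space. -/
theorem PointedCone.exists_coords [FiniteDimensional ℝ E] (C : PointedCone ℝ E) :
    ∃ (s : Finset E) (c : E → E →ₗ[ℝ] ℝ), (∀ b ∈ s, b ∈ C) ∧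
      (∀ b ∈ s, c b (∑ a ∈ s, a) = 1) ∧
      ∀ z ∈ Submodule.span ℝ (C : Set E), z = ∑ b ∈ s, c b z • b := by
  classical
  obtain ⟨b, hbC, hspan, hli⟩ := exists_linearIndependent ℝ (C : Set E)
  have hfin : b.Finite := hli.setFinite
  have hb : Fintype b := hfin.fintype
  let B := Module.Basis.span hli
  have hB : ∀ x : b, ((B x : Submodule.span ℝ (Set.range ((↑) : b → E))) : E) = x := fun x =>
    congrArg Subtype.val (Module.Basis.span_apply hli x)
  choose g hg using fun x : b => LinearMap.exists_extend (B.coord x)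
  have hg' : ∀ (x : b) (z : Submodule.span ℝ (Set.range ((↑) : b → E))),
      g x (z : E) = B.coord x z := fun x z => LinearMap.congr_fun (hg x) z
  refine ⟨hfin.toFinset, fun x => if h : x ∈ b then g ⟨x, h⟩ else 0, fun x hx => ?_,
    fun x hx => ?_, fun z hz => ?_⟩
  · exact hbC (hfin.mem_toFinset.1 hx)
  · have hx := hfin.mem_toFinset.1 hx
    simp only [dif_pos hx]
    have h1 : ∀ a : b, g ⟨x, hx⟩ (a : E) = if a = ⟨x, hx⟩ then 1 else 0 := by
      intro a
      rw [← hB a, hg', Module.Basis.coord_apply, Module.Basis.repr_self, Finsupp.single_apply]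
    rw [map_sum, Finset.sum_subtype hfin.toFinset (p := fun x => x ∈ b) (F := hb) (by simp)]
    simp only [h1]
    simp
  · have hz' : z ∈ Submodule.span ℝ (Set.range ((↑) : b → E)) := by
      rwa [Subtype.range_coe, hspan]
    have h1 := congrArg Subtype.val (B.sum_repr ⟨z, hz'⟩)
    rw [Finset.sum_subtype hfin.toFinset (p := fun x => x ∈ b) (by simp)]
    rw [Submodule.coe_sum] at h1
    refine h1.symm.trans (Finset.sum_congr rfl fun x _ => ?_)
    simp only [dif_pos x.2]
    rw [Submodule.coe_smul, hB, ← Module.Basis.coord_apply, ← hg']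

theorem PointedCone.coneCore_nonempty [FiniteDimensional ℝ E] (C : PointedCone ℝ E) :
    (coneCore (C : Set E)).Nonempty := by
  obtain ⟨s, c, hs, -, h⟩ := C.exists_coords
  refine ⟨∑ b ∈ s, b, C.sum_mem hs, fun y hy => ?_⟩
  have hpos : 0 < 1 + ∑ b ∈ s, |c b y| := by positivity
  refine ⟨(1 + ∑ b ∈ s, |c b y|)⁻¹, inv_pos.2 hpos, ?_⟩
  have hle : ∀ b ∈ s, (1 + ∑ b ∈ s, |c b y|)⁻¹ * c b y ≤ 1 := by
    intro b hb
    rw [inv_mul_le_one₀ hpos]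
    have := Finset.single_le_sum (fun b _ => abs_nonneg (c b y)) hb
    linarith [le_abs_self (c b y)]
  have : (∑ b ∈ s, b) - (1 + ∑ b ∈ s, |c b y|)⁻¹ • y =
      ∑ b ∈ s, (1 - (1 + ∑ b ∈ s, |c b y|)⁻¹ * c b y) • b := by
    conv_lhs => rw [h y (Submodule.subset_span hy)]
    simp only [sub_smul, one_smul, Finset.sum_sub_distrib, Finset.smul_sum, smul_smul]
    simp only [← h y (Submodule.subset_span hy)]
  rw [this]
  exact C.sum_mem fun b hb => C.real_smul_mem (sub_nonneg.2 (hle b hb)) (hs b hb)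

/-- In finite dimension, the topological relative interior of a cone is the algebraic one. -/
theorem PointedCone.intrinsicInterior_eq_coneCore [FiniteDimensional ℝ E] [TopologicalSpace E]
    [IsTopologicalAddGroup E] [ContinuousSMul ℝ E] [T2Space E] (C : PointedCone ℝ E) :
    intrinsicInterior ℝ (C : Set E) = coneCore (C : Set E) := by
  obtain ⟨s, c, hs, h1, h⟩ := C.exists_coords
  have hspan : (affineSpan ℝ (C : Set E) : Set E) = Submodule.span ℝ (C : Set E) := by
    have := affineSpan_insert_zero (k := ℝ) (C : Set E)
    rwa [Set.insert_eq_of_mem C.zero_mem] at this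
  ext x
  constructor
  · intro hx
    refine ⟨intrinsicInterior_subset hx, fun y hy => ?_⟩
    obtain ⟨x', hx', rfl⟩ := mem_intrinsicInterior.1 hx
    have hmem : ∀ t : ℝ, (x' : E) - t • y ∈ affineSpan ℝ (C : Set E) := by
      intro t
      have hx2 : (x' : E) ∈ (affineSpan ℝ (C : Set E) : Set E) := x'.2
      change (x' : E) - t • y ∈ (affineSpan ℝ (C : Set E) : Set E)
      rw [hspan] at hx2 ⊢
      exact Submodule.sub_mem _ hx2 (Submodule.smul_mem _ _ (Submodule.subset_span hy))
    let f : ℝ → affineSpan ℝ (C : Set E) := fun t => ⟨(x' : E) - t • y, hmem t⟩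
    have hf : Continuous f := Continuous.subtype_mk (by fun_prop) _
    have hf0 : f 0 = x' := Subtype.ext (by simp [f])
    have hn : ∀ᶠ t in nhds (0 : ℝ), f t ∈ interior ((↑) ⁻¹' (C : Set E)) :=
      hf.continuousAt.eventually_mem (isOpen_interior.mem_nhds (by rwa [hf0]))
    obtain ⟨δ, hδ, hball⟩ := Metric.eventually_nhds_iff.1 hn
    refine ⟨δ / 2, by positivity, ?_⟩
    have h2 : f (δ / 2) ∈ interior ((↑) ⁻¹' (C : Set E)) := hball (by
      rw [Real.dist_eq, sub_zero, abs_of_pos (by positivity)]; linarith)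
    have h3 : f (δ / 2) ∈ ((↑) ⁻¹' (C : Set E) : Set (affineSpan ℝ (C : Set E))) :=
      interior_subset h2
    exact h3
  · rintro ⟨hx, hdom⟩
    obtain ⟨ε, hε, hmem⟩ := hdom _ (C.sum_mem hs)
    have hxs : x ∈ Submodule.span ℝ (C : Set E) := Submodule.subset_span hx
    rw [mem_intrinsicInterior]
    refine ⟨⟨x, subset_affineSpan ℝ _ hx⟩, ?_, rfl⟩
    rw [mem_interior]
    -- As `x - ε ∑ b` lies in `C`, so does every `z` in the span whose coordinates exceed those of
    -- this point.
    let U : Set E := ⋂ b ∈ s, {z | -ε < c b (z - x)}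
    have hU : IsOpen U := isOpen_biInter_finset fun b _ =>
      isOpen_lt continuous_const
        ((LinearMap.continuous_of_finiteDimensional (c b)).comp (continuous_id.sub continuous_const))
    refine ⟨(↑) ⁻¹' U, fun z hz => ?_, hU.preimage continuous_subtype_val, ?_⟩
    · have hzs : (z : E) ∈ Submodule.span ℝ (C : Set E) := by
        have : (z : E) ∈ (affineSpan ℝ (C : Set E) : Set E) := z.2
        rwa [hspan] at this
      have hzU : ∀ b ∈ s, -ε < c b ((z : E) - x) := by
        intro b hb
        have := Set.mem_iInter₂.1 hz b hb
        exact this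
      have h2 : (z : E) = (x - ε • ∑ b ∈ s, b) + ∑ b ∈ s, (c b ((z : E) - x) + ε) • b := by
        simp only [add_smul, Finset.sum_add_distrib]
        rw [← h _ (Submodule.sub_mem _ hzs hxs), Finset.smul_sum]
        abel
      change (z : E) ∈ C
      rw [h2]
      exact C.add_mem hmem (C.sum_mem fun b hb =>
        C.real_smul_mem (by linarith [hzU b hb]) (hs b hb))
    · refine Set.mem_iInter₂.2 fun b _ => ?_
      change -ε < c b (x - x)
      rw [sub_self, map_zero]
      linarith

/-- A face is generated by each element of its relative interior. -/
theorem PointedCone.IsFaceOf.mem_iff {F C : PointedCone ℝ E} (hF : F.IsFaceOf C) {x : E}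
    (hx : x ∈ coneCore (F : Set E)) (y : E) :
    y ∈ F ↔ y ∈ C ∧ ConeDominated (C : Set E) y x := by
  constructor
  · intro hy
    refine ⟨hF.le hy, ?_⟩
    obtain ⟨ε, hε, h⟩ := hx.2 y hy
    exact ⟨ε, hε, hF.le h⟩
  · rintro ⟨hy, ε, hε, h⟩
    refine hF.mem_of_smul_add_mem hy h hε ?_
    rw [add_sub_cancel]
    exact hx.1

theorem exists_bound_inner {V : Type*} [NormedAddCommGroup V] [InnerProductSpace ℝ V]
    [FiniteDimensional ℝ V] (q : V →ₗ[ℝ] V →ₗ[ℝ] ℝ) :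
    ∃ M : ℝ, 0 < M ∧ ∀ x, q x x ≤ M * inner ℝ x x := by
  let q' : V →L[ℝ] V →L[ℝ] ℝ := LinearMap.toContinuousLinearMap
    ((LinearMap.toContinuousLinearMap : (V →ₗ[ℝ] ℝ) ≃ₗ[ℝ] (V →L[ℝ] ℝ)).toLinearMap ∘ₗ q)
  refine ⟨‖q'‖ + 1, by positivity, fun x => ?_⟩
  have h1 : q x x ≤ ‖q'‖ * ‖x‖ * ‖x‖ := (le_abs_self _).trans (q'.le_opNorm₂ x x)
  rw [real_inner_self_eq_norm_mul_norm]
  nlinarith [norm_nonneg x]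

/-- On a finite-dimensional space, every bilinear form is bounded by a positive definite one. -/
theorem exists_bound_of_posDef [FiniteDimensional ℝ E] (B q : E →ₗ[ℝ] E →ₗ[ℝ] ℝ)
    (hs : ∀ x y, B x y = B y x) (hn : ∀ x, 0 ≤ B x x) (hd : ∀ x, B x x = 0 → x = 0) :
    ∃ M : ℝ, 0 < M ∧ ∀ x, q x x ≤ M * B x x := by
  let core : InnerProductSpace.Core ℝ E :=
    { inner := fun x y => B x y
      conj_inner_symm := fun x y => hs y x
      re_inner_nonneg := hn
      add_left := fun x y z => by simp
      smul_left := fun x y c => by simp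
      definite := hd }
  exact @exists_bound_inner E core.toNormedAddCommGroup (InnerProductSpace.ofCore core.toCore) _ q

end Cone

/-! ### Faces of the dual cone -/

namespace TAlgebra

variable {r : ℕ} {A : Type*} [NonUnitalNonAssocRing A] [StarRing A] [Module ℝ A]

theorem mem_principalLTp (T : TAlgebra r A) {I : Finset (Fin r)} {a : A} :
    a ∈ T.principalLTp I ↔ (∀ i ∈ I, ∀ k, T.cp i k a = 0 ∧ T.cp k i a = 0) ∧ a ∈ T.lower ∧
      ∀ i ∉ I, 0 ≤ T.diag i a := by
  simp only [principalLTp, principal, Set.mem_ofPred_eq, mem_lower, T.comp_eq_zero_iff]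

theorem mem_principalLTpp (T : TAlgebra r A) {I : Finset (Fin r)} {a : A} :
    a ∈ T.principalLTpp I ↔ (∀ i ∈ I, ∀ k, T.cp i k a = 0 ∧ T.cp k i a = 0) ∧ a ∈ T.lower ∧
      ∀ i ∉ I, 0 < T.diag i a := by
  simp only [principalLTpp, principal, Set.mem_ofPred_eq, mem_lower, T.comp_eq_zero_iff]

/-- The indices of the vanishing diagonal entries. -/
noncomputable def zeros (T : TAlgebra r A) (t : A) : Finset (Fin r) :=
  Finset.univ.filter fun i => T.diag i t = 0

theorem mem_zeros (T : TAlgebra r A) {t : A} {i : Fin r} : i ∈ T.zeros t ↔ T.diag i t = 0 := by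
  simp [zeros]

theorem isProperLT_of_mem_principalLTpp (T : TAlgebra r A) {I : Finset (Fin r)} {t : A}
    (ht : t ∈ T.principalLTpp I) : T.IsProperLT t ∧ T.zeros t = I := by
  rw [mem_principalLTpp] at ht
  have h0 : ∀ i ∈ I, T.diag i t = 0 := fun i hi => T.diag_eq_zero_of_cp (ht.1 i hi i).1
  have h1 : ∀ i, T.diag i t = 0 → i ∈ I := fun i hi => by
    by_contra h
    exact (ht.2.2 i h).ne' hi
  refine ⟨T.isProperLT_iff.2 ⟨ht.2.1, fun i => ?_, fun i hi k => (ht.1 i (h1 i hi) k).2⟩, ?_⟩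
  · by_cases hi : i ∈ I
    · exact (h0 i hi).ge
    · exact (ht.2.2 i hi).le
  · ext i
    rw [mem_zeros]
    exact ⟨h1 i, h0 i⟩

theorem idem_mul_idem_compl (T : TAlgebra r A) (J : Finset (Fin r)) :
    T.idem J * T.idem Jᶜ = 0 :=
  T.ext_cp fun i j => by
    rw [cp_idem_mul, cp_idem, map_zero]
    by_cases h : i ∈ J <;> simp [h]

/-- Filling the vanishing diagonal entries of a proper element by ones. -/
theorem IsProperLT.completion {T : TAlgebra r A} {t : A} (ht : T.IsProperLT t) :
    t + T.idem (T.zeros t) ∈ T.LTpp ∧ (t + T.idem (T.zeros t)) * T.idem (T.zeros t)ᶜ = t := by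
  rw [isProperLT_iff] at ht
  refine ⟨T.mem_LTpp.2 ⟨T.lower.add_mem ht.1 (T.idem_mem_lower _), fun i => ?_⟩, ?_⟩
  · rw [map_add, diag_idem]
    split_ifs with h
    · rw [T.mem_zeros.1 h]; norm_num
    · rw [add_zero]
      exact lt_of_le_of_ne (ht.2.1 i) fun h' => h (T.mem_zeros.2 h'.symm)
  · rw [add_mul, idem_mul_idem_compl, add_zero]
    refine T.ext_cp fun i j => ?_
    rw [cp_mul_idem]
    split_ifs with h
    · rfl
    · rw [Finset.mem_compl, mem_zeros, not_not] at h
      rw [ht.2.2 j h]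

variable [IsScalarTower ℝ A A] [SMulCommClass ℝ A A]

/-- The lower triangular elements with positive diagonal whose rows and columns in `I` are those
of the unit element. -/
def fixer (T : TAlgebra r A) (I : Finset (Fin r)) : Set A :=
  {n | n ∈ T.LTpp ∧ T.idem I * n = T.idem I ∧ n * T.idem I = T.idem I}

theorem add_idem_mem_fixer (T : TAlgebra r A) {I : Finset (Fin r)} {t : A}
    (ht : t ∈ T.principalLTpp I) :
    t + T.idem I ∈ T.fixer I ∧ (t + T.idem I) * T.idem Iᶜ = t := by
  obtain ⟨h1, h2⟩ := T.isProperLT_of_mem_principalLTpp ht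
  have h3 := h1.completion
  rw [h2] at h3
  rw [mem_principalLTpp] at ht
  refine ⟨⟨h3.1, ?_, ?_⟩, h3.2⟩
  · rw [mul_add, idem_mul_idem, add_eq_right]
    refine T.ext_cp fun i j => ?_
    rw [cp_idem_mul, map_zero]
    split_ifs with h
    · exact (ht.1 i h j).1
    · rfl
  · rw [add_mul, idem_mul_idem, add_eq_right]
    refine T.ext_cp fun i j => ?_
    rw [cp_mul_idem, map_zero]
    split_ifs with h
    · exact (ht.1 j h i).2
    · rfl

theorem mul_idem_compl_of_mem_fixer (T : TAlgebra r A) {I : Finset (Fin r)} {n : A}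
    (hn : n ∈ T.fixer I) : n * T.idem Iᶜ + T.idem I = n := by
  conv_rhs => rw [← T.mul_unit n, ← T.idem_add_compl I, mul_add, hn.2.2]
  exact add_comm _ _

theorem mul_idem_compl_mem (T : TAlgebra r A) {I : Finset (Fin r)} {n : A}
    (hn : n ∈ T.fixer I) : n * T.idem Iᶜ ∈ T.principalLTpp I := by
  have hn1 := T.mem_LTpp.1 hn.1
  refine T.mem_principalLTpp.2 ⟨fun i hi k => ⟨?_, ?_⟩, T.lower_mul hn1.1 (T.idem_mem_lower _),
    fun i hi => ?_⟩
  · have h1 : n * T.idem Iᶜ = n - T.idem I := eq_sub_of_add_eq (T.mul_idem_compl_of_mem_fixer hn)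
    have h2 : T.cp i k (T.idem I * n) = T.cp i k (T.idem I) := by rw [hn.2.1]
    rw [cp_idem_mul, if_pos hi] at h2
    rw [h1, map_sub, h2, sub_self]
  · rw [cp_mul_idem, if_neg (by simpa using hi)]
  · rw [T.diag_mul hn1.1 (T.idem_mem_lower _), diag_idem, if_pos (by simpa using hi), mul_one]
    exact hn1.2 i

theorem unit_mem_fixer (T : TAlgebra r A) (I : Finset (Fin r)) : T.unit ∈ T.fixer I :=
  ⟨T.unit_mem_LTpp, T.mul_unit _, T.unit_mul _⟩

theorem mul_mem_fixer (T : TAlgebra r A) {I : Finset (Fin r)} {n m : A} (hn : n ∈ T.fixer I)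
    (hm : m ∈ T.fixer I) : n * m ∈ T.fixer I := by
  have hn1 := (T.mem_LTpp.1 hn.1).1
  have hm1 := (T.mem_LTpp.1 hm.1).1
  refine ⟨T.LTpp_mul hn.1 hm.1, ?_, ?_⟩
  · rw [← T.mul_assoc_lower (T.idem_mem_lower _) hn1, hn.2.1, hm.2.1]
  · rw [T.mul_assoc_lower hn1 hm1, hm.2.2, hn.2.2]

theorem inv_mem_fixer (T : TAlgebra r A) {I : Finset (Fin r)} {n m : A} (hn : n ∈ T.fixer I)
    (hm : m ∈ T.LTpp) (h1 : n * m = T.unit) (h2 : m * n = T.unit) : m ∈ T.fixer I := by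
  have hn1 := (T.mem_LTpp.1 hn.1).1
  have hm1 := (T.mem_LTpp.1 hm).1
  refine ⟨hm, ?_, ?_⟩
  · have := T.mul_assoc_lower (T.idem_mem_lower I) hn1 m
    rwa [hn.2.1, h1, mul_unit] at this
  · have := T.mul_assoc_lower hm1 hn1 (T.idem I)
    rw [hn.2.2, h2, unit_mul] at this
    exact this.symm

variable [StarModule ℝ A]

/-- The elements of the dual cone whose rows (and columns) with index in `I` vanish. -/
noncomputable def principalFace (T : TAlgebra r A) (I : Finset (Fin r)) : Set (Herm A) :=
  {y | y ∈ T.dualCone ∧ ∀ i ∈ I, ∀ k, T.cp i k (y : A) = 0}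

theorem hermIdem_mem_principalFace (T : TAlgebra r A) (I : Finset (Fin r)) :
    T.hermIdem Iᶜ ∈ T.principalFace I := by
  refine ⟨T.hermIdem_mem_dualCone _, fun i hi k => ?_⟩
  rw [coe_hermIdem, cp_idem, if_neg]
  simp [hi]

theorem quadMap_idem_of_mem (T : TAlgebra r A) {I : Finset (Fin r)} {y : Herm A}
    (hy : ∀ i ∈ I, ∀ k, T.cp i k (y : A) = 0) : quadMap (T.idem Iᶜ) y = y := by
  refine Subtype.ext (T.ext_cp fun i j => ?_)
  rw [coe_quadMap_idem_cp]
  split_ifs with h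
  · rfl
  · simp only [Finset.mem_compl, not_and_or, not_not] at h
    rcases h with h | h
    · rw [hy i h]
    · rw [T.cp_symm (hy j h i)]

theorem quadMap_hermIdem (T : TAlgebra r A) {l : A} (hl : l ∈ T.lower) (J : Finset (Fin r)) :
    quadMap l (T.hermIdem J) = mulStar (l * T.idem J) :=
  T.quadMap_mulStar hl (T.idem_mem_lower J)

variable [FiniteDimensional ℝ A]

theorem exists_quadMap_inv (T : TAlgebra r A) {l : A} (hl : l ∈ T.LTpp) :
    ∃ m ∈ T.LTpp, l * m = T.unit ∧ m * l = T.unit ∧ (∀ b, quadMap m (quadMap l b) = b) ∧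
      ∀ b, quadMap l (quadMap m b) = b := by
  obtain ⟨m, hm, h1, h2⟩ := T.exists_inv hl
  have hl1 := (T.mem_LTpp.1 hl).1
  have hm1 := (T.mem_LTpp.1 hm).1
  refine ⟨m, hm, h1, h2, fun b => ?_, fun b => ?_⟩
  · rw [T.quadMap_quadMap hm1 hl1, h2, quadMap_unit]
  · rw [T.quadMap_quadMap hl1 hm1, h1, quadMap_unit]

theorem quadMap_bijective (T : TAlgebra r A) {l : A} (hl : l ∈ T.LTpp) :
    Function.Bijective (quadMap l : Herm A →ₗ[ℝ] Herm A) := by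
  obtain ⟨m, -, -, -, h1, h2⟩ := T.exists_quadMap_inv hl
  exact Function.bijective_iff_has_inverse.2 ⟨quadMap m, h1, h2⟩

theorem quadMap_image_dualCone (T : TAlgebra r A) {l : A} (hl : l ∈ T.LTpp) :
    quadMap l '' (T.dualCone : Set (Herm A)) = T.dualCone := by
  obtain ⟨m, hm, -, -, h1, h2⟩ := T.exists_quadMap_inv hl
  ext y
  constructor
  · rintro ⟨x, hx, rfl⟩
    exact T.quadMap_mem_dualCone (T.LTpp_subset_LTp hl) hx
  · intro hy
    exact ⟨_, T.quadMap_mem_dualCone (T.LTpp_subset_LTp hm) hy, h2 y⟩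

theorem isTriangularDualAut_quadMap (T : TAlgebra r A) {l : A} (hl : l ∈ T.LTpp) :
    T.IsTriangularDualAut (quadMap l) :=
  ⟨⟨T.quadMap_bijective hl, T.quadMap_image_dualCone hl⟩, l, hl, rfl⟩

theorem coneDominated_quadMap_iff (T : TAlgebra r A) {l : A} (hl : l ∈ T.LTpp) (x y : Herm A) :
    ConeDominated (T.dualCone : Set (Herm A)) (quadMap l x) (quadMap l y) ↔
      ConeDominated (T.dualCone : Set (Herm A)) x y := by
  have := coneDominated_image_iff (quadMap l) (T.quadMap_bijective hl).1
    (T.dualCone : Set (Herm A)) x y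
  rwa [T.quadMap_image_dualCone hl] at this

/-- The unit element is an order unit of the dual cone. -/
theorem exists_unit_sub_smul_mem (T : TAlgebra r A) (y : Herm A) :
    ∃ ε : ℝ, 0 < ε ∧ T.hermIdem Finset.univ - ε • y ∈ T.dualCone := by
  let B : A →ₗ[ℝ] A →ₗ[ℝ] ℝ := LinearMap.mk₂ ℝ (fun u v => T.tr (u * star v))
    (fun a a' b => by simp [add_mul]) (fun c a b => by simp [smul_mul_assoc])
    (fun a b b' => by simp [mul_add]) (fun c a b => by simp [mul_smul_comm])
  let q : A →ₗ[ℝ] A →ₗ[ℝ] ℝ := LinearMap.mk₂ ℝ (fun u v => T.tr ((u * star v) * (y : A)))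
    (fun a a' b => by simp [add_mul]) (fun c a b => by simp [smul_mul_assoc])
    (fun a b b' => by simp [mul_add, add_mul])
    (fun c a b => by simp [mul_smul_comm, smul_mul_assoc])
  obtain ⟨M, hM, h⟩ := exists_bound_of_posDef B q
    (fun x z => by
      change T.tr (x * star z) = T.tr (z * star x)
      rw [← T.tr_star, star_mul, star_star])
    (fun x => T.tr_mul_star_nonneg x) (fun x => (T.tr_mul_star_eq_zero x).1)
  refine ⟨M⁻¹, inv_pos.2 hM, ?_⟩
  rw [mem_dualCone]
  intro u _
  have h1 : T.tr ((u * star u) * (y : A)) ≤ M * T.tr (u * star u) := h u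
  rw [map_sub, map_smul, inner_unit, inner_apply, coe_mulStar, smul_eq_mul, sub_nonneg,
    inv_mul_le_iff₀ hM]
  exact h1

/-- The principal face is the face of the dual cone generated by `∑ i ∉ I, e_i`. -/
theorem mem_principalFace_iff (T : TAlgebra r A) (I : Finset (Fin r)) (y : Herm A) :
    y ∈ T.principalFace I ↔
      y ∈ T.dualCone ∧ ConeDominated (T.dualCone : Set (Herm A)) y (T.hermIdem Iᶜ) := by
  refine and_congr_right fun hy => ⟨fun h => ?_, ?_⟩
  · obtain ⟨ε, hε, h1⟩ := T.exists_unit_sub_smul_mem y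
    refine ⟨ε, hε, ?_⟩
    have h2 := T.quadMap_mem_dualCone (T.idem_mem_LTp Iᶜ) h1
    rw [map_sub, map_smul, T.quadMap_idem_of_mem h, T.quadMap_hermIdem (T.idem_mem_lower _)] at h2
    have h3 : T.idem Iᶜ * T.idem Finset.univ = T.idem Iᶜ := T.mul_unit _
    rwa [h3] at h2
  · rintro ⟨ε, hε, h⟩ i hi k
    obtain ⟨t, ht, rfl⟩ := T.exists_isProperLT hy
    have h1 := T.diag_nonneg h i
    have h2 : ((T.hermIdem Iᶜ - ε • mulStar t : Herm A) : A) =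
        T.idem Iᶜ - ε • (t * star t) := by
      rw [← coe_hermIdem]; rfl
    rw [h2, map_sub, map_smul, diag_idem, if_neg (by simpa using hi), smul_eq_mul] at h1
    have h3 := T.diag_mul_star_nonneg i t
    have h4 : T.diag i (t * star t) = 0 := by nlinarith
    rw [coe_mulStar, T.cp_mul_star]
    exact Finset.sum_eq_zero fun j _ => by rw [T.cp_eq_zero_of_diag_mul_star h4, zero_mul]

theorem IsProperLT.mem_principalLTp {T : TAlgebra r A} {t : A} (ht : T.IsProperLT t)
    {I : Finset (Fin r)} (h : ∀ i ∈ I, ∀ k, T.cp i k (t * star t) = 0) :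
    t ∈ T.principalLTp I := by
  refine T.mem_principalLTp.2 ⟨fun i hi k => ht.cp_eq_zero (T.diag_eq_zero_of_cp (h i hi i)) k,
    ?_, fun i _ => ?_⟩
  · exact (T.isProperLT_iff.1 ht).1
  · exact (T.isProperLT_iff.1 ht).2.1 i

theorem image_principalLTp (T : TAlgebra r A) (I : Finset (Fin r)) :
    mulStar '' T.principalLTp I = T.principalFace I := by
  ext y
  constructor
  · rintro ⟨t, ht, rfl⟩
    rw [T.mem_principalLTp] at ht
    refine ⟨T.mulStar_mem_dualCone ht.2.1, fun i hi k => ?_⟩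
    rw [coe_mulStar, T.cp_mul_star]
    exact Finset.sum_eq_zero fun j _ => by rw [(ht.1 i hi j).1, zero_mul]
  · rintro ⟨hy, h⟩
    obtain ⟨t, ht, rfl⟩ := T.exists_isProperLT hy
    exact ⟨t, ht.mem_principalLTp h, rfl⟩

theorem quadMap_mem_principalFace (T : TAlgebra r A) {I : Finset (Fin r)} {n : A}
    (hn : n ∈ T.fixer I) {y : Herm A} (hy : y ∈ T.principalFace I) :
    quadMap n y ∈ T.principalFace I := by
  refine ⟨T.quadMap_mem_dualCone (T.LTpp_subset_LTp hn.1) hy.1, fun i hi k => ?_⟩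
  have h : T.cp i k (T.idem I * (n * ((y : A) * star n))) =
      T.cp i k (T.idem I * ((y : A) * star n)) := by
    rw [← T.mul_assoc_lower (T.idem_mem_lower _) (T.mem_LTpp.1 hn.1).1, hn.2.1]
  rw [cp_idem_mul, cp_idem_mul, if_pos hi, if_pos hi] at h
  rw [T.quadMap_coe (T.mem_LTpp.1 hn.1).1, h, T.cp_mul]
  exact Finset.sum_eq_zero fun j _ => by rw [hy.2 i hi j, zero_mul]

theorem quadMap_image_principalFace (T : TAlgebra r A) {I : Finset (Fin r)} {n : A}
    (hn : n ∈ T.fixer I) : quadMap n '' T.principalFace I = T.principalFace I := by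
  obtain ⟨m, hm, h1, h2, -, h4⟩ := T.exists_quadMap_inv hn.1
  have hm' := T.inv_mem_fixer hn hm h1 h2
  ext y
  constructor
  · rintro ⟨x, hx, rfl⟩
    exact T.quadMap_mem_principalFace hn hx
  · intro hy
    exact ⟨_, T.quadMap_mem_principalFace hm' hy, h4 y⟩

theorem hermIdem_mem_coneCore (T : TAlgebra r A) (I : Finset (Fin r)) :
    T.hermIdem Iᶜ ∈ coneCore (T.principalFace I) := by
  refine ⟨T.hermIdem_mem_principalFace I, fun y hy => ?_⟩
  obtain ⟨ε, hε, h⟩ := ((T.mem_principalFace_iff I y).1 hy).2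
  refine ⟨ε, hε, h, fun i hi k => ?_⟩
  have h1 := (T.hermIdem_mem_principalFace I).2 i hi k
  have h2 : ((T.hermIdem Iᶜ - ε • y : Herm A) : A) = (T.hermIdem Iᶜ : A) - ε • (y : A) := rfl
  rw [h2, map_sub, map_smul, h1, hy.2 i hi k, smul_zero, sub_zero]

/-- The triangular automorphism attached to a proper element `t` carries the face generated by
`t t^*` to a principal face. -/
theorem IsProperLT.exists_normalize {T : TAlgebra r A} {t : A} (ht : T.IsProperLT t) :
    ∃ l ∈ T.LTpp, quadMap l (T.hermIdem (T.zeros t)ᶜ) = mulStar t := by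
  obtain ⟨h1, h2⟩ := ht.completion
  exact ⟨_, h1, by rw [T.quadMap_hermIdem (T.mem_LTpp.1 h1).1, h2]⟩

/-- If `t` is proper and `t t^*` generates a face containing `∑ i ∈ J, e_i`, then the diagonal
entries of `t` with index in `J` are positive. -/
theorem IsProperLT.zeros_subset {T : TAlgebra r A} {t : A} (ht : T.IsProperLT t)
    {J : Finset (Fin r)}
    (h : ConeDominated (T.dualCone : Set (Herm A)) (T.hermIdem J) (mulStar t)) :
    T.zeros t ⊆ Jᶜ := by
  obtain ⟨l, hl, hlt⟩ := ht.exists_normalize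
  obtain ⟨m, hm, -, -, -, h4⟩ := T.exists_quadMap_inv hl
  rw [← hlt, ← h4 (T.hermIdem J), T.coneDominated_quadMap_iff hl] at h
  have h1 := (T.mem_principalFace_iff _ _).2
    ⟨T.quadMap_mem_dualCone (T.LTpp_subset_LTp hm) (T.hermIdem_mem_dualCone J), h⟩
  intro i hi
  have h2 := T.diag_eq_zero_of_cp (h1.2 i hi i)
  have hm1 := T.mem_LTpp.1 hm
  rw [T.quadMap_hermIdem hm1.1, coe_mulStar] at h2
  have h3 := T.diag_eq_zero_of_cp (T.cp_eq_zero_of_diag_mul_star h2 i)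
  rw [T.diag_mul hm1.1 (T.idem_mem_lower _), diag_idem] at h3
  rw [Finset.mem_compl]
  intro hJ
  rw [if_pos hJ, mul_one] at h3
  exact (hm1.2 i).ne' h3

theorem image_principalLTpp (T : TAlgebra r A) (I : Finset (Fin r)) :
    mulStar '' T.principalLTpp I = coneCore (T.principalFace I) := by
  ext y
  constructor
  · rintro ⟨t, ht, rfl⟩
    obtain ⟨h1, h2⟩ := T.add_idem_mem_fixer ht
    have h3 : quadMap (t + T.idem I) (T.hermIdem Iᶜ) = mulStar t := by
      rw [T.quadMap_hermIdem (T.mem_LTpp.1 h1.1).1, h2]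
    rw [← h3, ← T.quadMap_image_principalFace h1,
      coneCore_image _ (T.quadMap_bijective h1.1).1]
    exact ⟨_, T.hermIdem_mem_coneCore I, rfl⟩
  · rintro ⟨hy, h⟩
    obtain ⟨t, ht, rfl⟩ := T.exists_isProperLT hy.1
    obtain ⟨ε, hε, h1⟩ := h _ (T.hermIdem_mem_principalFace I)
    have h2 := ht.zeros_subset ⟨ε, hε, h1.1⟩
    rw [compl_compl] at h2
    obtain ⟨h3, h4, h5⟩ := T.mem_principalLTp.1 (ht.mem_principalLTp hy.2)
    refine ⟨t, T.mem_principalLTpp.2 ⟨h3, h4, fun i hi => ?_⟩, rfl⟩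
    exact lt_of_le_of_ne (h5 i hi) fun h6 => hi (h2 (T.mem_zeros.2 h6.symm))

/-- The fixer of `I` acts freely on `∑ i ∉ I, e_i`. -/
theorem eq_of_quadMap_hermIdem_eq (T : TAlgebra r A) {I : Finset (Fin r)} {n m : A}
    (hn : n ∈ T.fixer I) (hm : m ∈ T.fixer I)
    (h : quadMap n (T.hermIdem Iᶜ) = quadMap m (T.hermIdem Iᶜ)) : n = m := by
  rw [T.quadMap_hermIdem (T.mem_LTpp.1 hn.1).1, T.quadMap_hermIdem (T.mem_LTpp.1 hm.1).1] at h
  have := (T.isProperLT_of_mem_principalLTpp (T.mul_idem_compl_mem hn)).1.unique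
    (T.isProperLT_of_mem_principalLTpp (T.mul_idem_compl_mem hm)).1 h
  rw [← T.mul_idem_compl_of_mem_fixer hn, this, T.mul_idem_compl_of_mem_fixer hm]

/-- The fixer of `I` acts transitively on the relative interior of the principal face. -/
theorem exists_fixer_of_mem_coneCore (T : TAlgebra r A) {I : Finset (Fin r)} {x : Herm A}
    (hx : x ∈ coneCore (T.principalFace I)) :
    ∃ n ∈ T.fixer I, quadMap n (T.hermIdem Iᶜ) = x := by
  rw [← image_principalLTpp] at hx
  obtain ⟨t, ht, rfl⟩ := hx
  obtain ⟨h1, h2⟩ := T.add_idem_mem_fixer ht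
  exact ⟨_, h1, by rw [T.quadMap_hermIdem (T.mem_LTpp.1 h1.1).1, h2]⟩

theorem principalFace_empty (T : TAlgebra r A) : T.principalFace ∅ = T.dualCone := by
  ext y
  simp [principalFace]

/-- Every face of the dual cone is a triangular image of a principal face. -/
theorem exists_eq_image_principalFace (T : TAlgebra r A) {F : PointedCone ℝ (Herm A)}
    (hF : F.IsFaceOf T.dualCone) :
    ∃ l ∈ T.LTpp, ∃ I, (F : Set (Herm A)) = quadMap l '' T.principalFace I := by
  obtain ⟨x, hx⟩ := F.coneCore_nonempty
  obtain ⟨t, ht, rfl⟩ := T.exists_isProperLT (hF.le hx.1)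
  obtain ⟨l, hl, hlt⟩ := ht.exists_normalize
  refine ⟨l, hl, T.zeros t, ?_⟩
  ext y
  rw [SetLike.mem_coe, hF.mem_iff hx, ← hlt]
  obtain ⟨y, rfl⟩ := (T.quadMap_bijective hl).2 y
  have h1 : quadMap l y ∈ T.dualCone ↔ y ∈ T.dualCone := by
    rw [← SetLike.mem_coe, ← T.quadMap_image_dualCone hl,
      (T.quadMap_bijective hl).1.mem_set_image, SetLike.mem_coe]
  rw [T.coneDominated_quadMap_iff hl, (T.quadMap_bijective hl).1.mem_set_image,
    mem_principalFace_iff, h1]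

/-- The compression to the blocks outside `I` projects the dual cone onto the principal face. -/
theorem quadMap_idem_image (T : TAlgebra r A) (I : Finset (Fin r)) :
    quadMap (T.idem Iᶜ) '' (T.dualCone : Set (Herm A)) = T.principalFace I := by
  ext y
  constructor
  · rintro ⟨x, hx, rfl⟩
    refine ⟨T.quadMap_mem_dualCone (T.idem_mem_LTp _) hx, fun i hi k => ?_⟩
    rw [coe_quadMap_idem_cp, if_neg]
    simp [hi]
  · intro hy
    exact ⟨y, hy.1, T.quadMap_idem_of_mem hy.2⟩

theorem principalDual_eq (T : TAlgebra r A) (I : Finset (Fin r)) :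
    T.principalDual I = coneCore (T.principalFace I) := T.image_principalLTpp I

/-- The principal face is the closure of its relative interior. -/
theorem closure_principalDual (T : TAlgebra r A) [TopologicalSpace A] [IsTopologicalAddGroup A]
    [ContinuousSMul ℝ A] [T2Space A] (I : Finset (Fin r)) :
    closure (T.principalDual I) = T.principalFace I := by
  apply subset_antisymm
  · refine closure_minimal ?_ ?_
    · rw [principalDual_eq]
      exact fun x hx => hx.1
    · have h1 : T.principalFace I = (⋂ u ∈ T.UTpp, {y | 0 ≤ T.inner (mulStar u) y}) ∩
          ⋂ i ∈ I, ⋂ k, {y : Herm A | T.cp i k (y : A) = 0} := by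
        ext y
        simp [principalFace, mem_dualCone]
      rw [h1]
      refine IsClosed.inter ?_ ?_
      · exact isClosed_biInter fun u _ => isClosed_le continuous_const
          (LinearMap.continuous_of_finiteDimensional (T.inner (mulStar u)))
      · exact isClosed_biInter fun i _ => isClosed_iInter fun k => isClosed_eq
          ((LinearMap.continuous_of_finiteDimensional (T.cp i k)).comp continuous_subtype_val)
          continuous_const
  · intro y hy
    have hcore := T.hermIdem_mem_coneCore I
    have h2 : ∀ ε : ℝ, 0 < ε → y + ε • T.hermIdem Iᶜ ∈ T.principalDual I := by
      intro ε hε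
      rw [principalDual_eq]
      have hadd : ∀ {a b : Herm A} {c : ℝ}, 0 ≤ c → a ∈ T.principalFace I →
          b ∈ T.principalFace I → a + c • b ∈ T.principalFace I := by
        intro a b c hc ha hb
        refine ⟨T.dualCone.add_mem ha.1 (T.dualCone.real_smul_mem hc hb.1), fun i hi k => ?_⟩
        have h2 : ((a + c • b : Herm A) : A) = (a : A) + c • (b : A) := rfl
        rw [h2, map_add, map_smul, ha.2 i hi k, hb.2 i hi k, smul_zero, add_zero]
      refine ⟨hadd hε.le hy hcore.1, fun z hz => ?_⟩
      obtain ⟨δ, hδ, h3⟩ := hcore.2 z hz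
      refine ⟨ε * δ, mul_pos hε hδ, ?_⟩
      have h4 : y + ε • T.hermIdem Iᶜ - (ε * δ) • z = y + ε • (T.hermIdem Iᶜ - δ • z) := by
        rw [smul_sub, smul_smul, add_sub_assoc]
      rw [h4]
      exact hadd hε.le hy h3
    have hc : Continuous fun ε : ℝ => y + ε • T.hermIdem Iᶜ := by fun_prop
    have h3 : Filter.Tendsto (fun ε : ℝ => y + ε • T.hermIdem Iᶜ) (nhdsWithin 0 (Set.Ioi 0))
        (nhds y) := by
      have := (hc.tendsto 0).mono_left (nhdsWithin_le_nhds (s := Set.Ioi 0))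
      simpa using this
    refine mem_closure_of_tendsto h3 ?_
    filter_upwards [self_mem_nhdsWithin] with ε hε using h2 ε hε

end TAlgebra

/-! ### T-algebras with reversed order of the indices -/

/-- An identification of a `*`-algebra `B` with the sum of the blocks of `T` with both indices in
the range of a strictly antitone map `idx`. -/
structure BlockEmbedding {r : ℕ} {A : Type*} [NonUnitalNonAssocRing A] [StarRing A] [Module ℝ A]
    (T : TAlgebra r A) (s : ℕ) (B : Type*) [NonUnitalNonAssocRing B] [StarRing B]
    [Module ℝ B] where
  /-- the embedding of the algebra -/
  map : B →ₗ[ℝ] A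
  injective : Function.Injective map
  map_mul : ∀ a b, map (a * b) = map a * map b
  map_star : ∀ a, map (star a) = star (map a)
  /-- the indices of the blocks, in decreasing order -/
  idx : Fin s → Fin r
  strictAnti : StrictAnti idx
  cp_map : ∀ (b : B) (i j : Fin r), (i ∉ Set.range idx ∨ j ∉ Set.range idx) →
    T.cp i j (map b) = 0
  exists_map_eq : ∀ a : A, (∀ i j, (i ∉ Set.range idx ∨ j ∉ Set.range idx) → T.cp i j a = 0) →
    ∃ b, map b = a

namespace BlockEmbedding

variable {r s : ℕ} {A B : Type*} [NonUnitalNonAssocRing A] [StarRing A] [Module ℝ A]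
  [NonUnitalNonAssocRing B] [StarRing B] [Module ℝ B] {T : TAlgebra r A}

theorem exists_map_eq_of_mem (φ : BlockEmbedding T s B) {i j : Fin s} {a : A}
    (ha : a ∈ T.grade (φ.idx i) (φ.idx j)) : ∃ b, φ.map b = a := by
  refine φ.exists_map_eq a fun k l h => T.cp_of_mem_ne ha ?_
  intro h'
  simp only [Prod.mk.injEq] at h'
  rcases h with h | h
  · exact h ⟨i, h'.1⟩
  · exact h ⟨j, h'.2⟩

theorem sum_cp_map (φ : BlockEmbedding T s B) (b : B) :
    ∑ i, ∑ j, T.cp (φ.idx i) (φ.idx j) (φ.map b) = φ.map b := by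
  conv_rhs => rw [← T.sum_cp (φ.map b)]
  refine Fintype.sum_of_injective φ.idx φ.strictAnti.injective _ _ (fun i hi => ?_) fun i => ?_
  · exact Finset.sum_eq_zero fun j _ => φ.cp_map b i j (Or.inl hi)
  · exact Fintype.sum_of_injective φ.idx φ.strictAnti.injective _ _
      (fun j hj => φ.cp_map b _ j (Or.inr hj)) fun j => rfl

theorem pair_ne (φ : BlockEmbedding T s B) {p q : Fin s × Fin s} (h : p ≠ q) :
    (φ.idx p.1, φ.idx p.2) ≠ (φ.idx q.1, φ.idx q.2) := by
  intro h'
  simp only [Prod.mk.injEq] at h'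
  exact h (Prod.ext (φ.strictAnti.injective h'.1) (φ.strictAnti.injective h'.2))

/-- The grading of `B` induced by a block embedding. -/
def matrixAlgebra (φ : BlockEmbedding T s B) : MatrixAlgebra s B where
  grade i j := (T.grade (φ.idx i) (φ.idx j)).comap φ.map
  isInternal := by
    apply DirectSum.isInternal_submodule_of_iSupIndep_of_iSup_eq_top
    · intro p
      rw [Submodule.disjoint_def]
      intro x hx hx'
      have hle : (⨆ q, ⨆ (_ : q ≠ p), (T.grade (φ.idx q.1) (φ.idx q.2)).comap φ.map) ≤
          LinearMap.ker (T.cp (φ.idx p.1) (φ.idx p.2) ∘ₗ φ.map) := by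
        refine iSup_le fun q => iSup_le fun hq y hy => ?_
        exact T.cp_of_mem_ne hy (φ.pair_ne hq)
      have h1 : T.cp (φ.idx p.1) (φ.idx p.2) (φ.map x) = 0 := hle hx'
      rw [T.cp_of_mem hx] at h1
      exact φ.injective (h1.trans (map_zero _).symm)
    · rw [eq_top_iff]
      intro b _
      choose g hg using fun i j => φ.exists_map_eq_of_mem (i := i) (j := j)
        (T.cp_mem (φ.idx i) (φ.idx j) (φ.map b))
      have hb : b = ∑ i, ∑ j, g i j := by
        apply φ.injective
        simp only [map_sum, hg, φ.sum_cp_map]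
      rw [hb]
      refine Submodule.sum_mem _ fun i _ => Submodule.sum_mem _ fun j _ => ?_
      refine Submodule.mem_iSup_of_mem (i, j) ?_
      rw [Submodule.mem_comap, hg]
      exact T.cp_mem _ _ _
  mul_mem ha hb := by
    rw [Submodule.mem_comap] at *
    rw [φ.map_mul]
    exact T.mul_mem ha hb
  mul_eq_zero h ha hb := by
    rw [Submodule.mem_comap] at *
    apply φ.injective
    rw [φ.map_mul, T.mul_eq_zero (fun h' => h (φ.strictAnti.injective h')) ha hb, map_zero]
  star_mem ha := by
    rw [Submodule.mem_comap] at *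
    rw [φ.map_star]
    exact T.star_mem ha

theorem map_cp (φ : BlockEmbedding T s B) (i j : Fin s) (b : B) :
    φ.map (φ.matrixAlgebra.cp i j b) = T.cp (φ.idx i) (φ.idx j) (φ.map b) := by
  conv_rhs => rw [← φ.matrixAlgebra.sum_cp b]
  simp only [map_sum]
  have hm : ∀ k l, φ.map (φ.matrixAlgebra.cp k l b) ∈ T.grade (φ.idx k) (φ.idx l) :=
    fun k l => φ.matrixAlgebra.cp_mem k l b
  rw [Finset.sum_eq_single i, Finset.sum_eq_single j, T.cp_of_mem (hm i j)]
  · intro l _ hl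
    exact T.cp_of_mem_ne (hm i l) (φ.pair_ne (p := (i, l)) (q := (i, j))
      fun h => hl (congrArg Prod.snd h))
  · simp
  · intro k _ hk
    exact Finset.sum_eq_zero fun l _ => T.cp_of_mem_ne (hm k l)
      (φ.pair_ne (p := (k, l)) (q := (i, j)) fun h => hk (congrArg Prod.fst h))
  · simp

/-- The block embedding on the block in position `(i, i)`. -/
noncomputable def diagEquiv (φ : BlockEmbedding T s B) (i : Fin s) :
    φ.matrixAlgebra.grade i i ≃ₗ[ℝ] T.grade (φ.idx i) (φ.idx i) :=
  LinearEquiv.ofBijective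
    (φ.map.restrict (p := φ.matrixAlgebra.grade i i) (q := T.grade (φ.idx i) (φ.idx i))
      fun _ hx => hx)
    ⟨fun _ _ h => Subtype.ext (φ.injective (congrArg Subtype.val h)), fun a => by
      obtain ⟨b, hb⟩ := φ.exists_map_eq_of_mem a.2
      have hmem : b ∈ φ.matrixAlgebra.grade i i := by
        change φ.map b ∈ T.grade (φ.idx i) (φ.idx i)
        rw [hb]
        exact a.2
      exact ⟨⟨b, hmem⟩, Subtype.ext hb⟩⟩

/-- The matrix algebra `B`, with the identification of the diagonal blocks inherited from `T`. -/
noncomputable def diagMatrixAlgebra (φ : BlockEmbedding T s B) : DiagMatrixAlgebra s B where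
  toMatrixAlgebra := φ.matrixAlgebra
  rho i := (φ.diagEquiv i).trans (T.rho (φ.idx i))
  rho_mul i a b := by
    simp only [LinearEquiv.trans_apply]
    rw [← T.rho_mul]
    congr 1
    exact Subtype.ext (φ.map_mul _ _)

theorem diag_eq (φ : BlockEmbedding T s B) (i : Fin s) (b : B) :
    φ.diagMatrixAlgebra.diag i b = T.diag (φ.idx i) (φ.map b) := by
  have h : φ.diagEquiv i (φ.matrixAlgebra.comp i i b) = T.comp (φ.idx i) (φ.idx i) (φ.map b) :=
    Subtype.ext (φ.map_cp i i b)
  exact congrArg (T.rho (φ.idx i)) h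

theorem map_e (φ : BlockEmbedding T s B) (i : Fin s) :
    φ.map (φ.diagMatrixAlgebra.e i) = T.e (φ.idx i) := by
  have h : φ.diagEquiv i ((φ.diagMatrixAlgebra.rho i).symm 1) = (T.rho (φ.idx i)).symm 1 := by
    apply (T.rho (φ.idx i)).injective
    rw [LinearEquiv.apply_symm_apply]
    exact (φ.diagMatrixAlgebra.rho i).apply_symm_apply 1
  exact congrArg Subtype.val h

theorem tr_eq (φ : BlockEmbedding T s B) (b : B) :
    φ.diagMatrixAlgebra.tr b = T.tr (φ.map b) := by
  rw [DiagMatrixAlgebra.tr_apply, DiagMatrixAlgebra.tr_apply]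
  exact Fintype.sum_of_injective φ.idx φ.strictAnti.injective _ _
    (fun i hi => T.diag_eq_zero_of_cp (φ.cp_map b i i (Or.inl hi))) fun i => φ.diag_eq i b

/-- The T-algebra `B`. Its axioms of associativity hold because those of `T` are symmetric under
reversal of the order of the indices. -/
noncomputable def tAlgebra (φ : BlockEmbedding T s B) : TAlgebra s B where
  toDiagMatrixAlgebra := φ.diagMatrixAlgebra
  e_mul i j a ha := φ.injective (by rw [φ.map_mul, φ.map_e]; exact T.e_mul _ _ _ ha)
  mul_e i j a ha := φ.injective (by rw [φ.map_mul, φ.map_e]; exact T.mul_e _ _ _ ha)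
  tr_mul_comm a b := by
    rw [φ.tr_eq, φ.tr_eq, φ.map_mul, φ.map_mul, T.tr_mul_comm]
  tr_mul_assoc a b c := by
    rw [φ.tr_eq, φ.tr_eq, φ.map_mul, φ.map_mul, φ.map_mul, φ.map_mul, T.tr_mul_assoc]
  tr_mul_star_nonneg a := by
    rw [φ.tr_eq, φ.map_mul, φ.map_star]
    exact T.tr_mul_star_nonneg _
  tr_mul_star_eq_zero a := by
    rw [φ.tr_eq, φ.map_mul, φ.map_star, T.tr_mul_star_eq_zero]
    exact map_eq_zero_iff φ.map φ.injective
  mul_assoc_upper i j k l a b c h1 h2 h3 ha hb hc := by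
    apply φ.injective
    rw [φ.map_mul, φ.map_mul, φ.map_mul, φ.map_mul]
    have h1' := φ.strictAnti.antitone h1
    have h2' := φ.strictAnti.antitone h2
    have h3' := φ.strictAnti.antitone h3
    refine (T.assoc_of_not_separated ?_ ?_ _ _ _ ha hb hc).symm <;>
      simp only [lt_min_iff, max_lt_iff] <;> omega
  mul_assoc_star i j k l a b c h1 h2 h3 ha hb hc := by
    apply φ.injective
    rw [φ.map_mul, φ.map_mul, φ.map_mul, φ.map_mul, φ.map_star]
    have h1' := φ.strictAnti.antitone h1
    have h2' := φ.strictAnti.antitone h2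
    have h3' := φ.strictAnti.antitone h3
    refine (T.assoc_of_not_separated ?_ ?_ _ _ _ ha hb (T.star_mem hc)).symm <;>
      simp only [lt_min_iff, max_lt_iff] <;> omega

theorem tAlgebra_comp_eq_zero_iff (φ : BlockEmbedding T s B) (i j : Fin s) (b : B) :
    φ.tAlgebra.comp i j b = 0 ↔ T.cp (φ.idx i) (φ.idx j) (φ.map b) = 0 := by
  rw [φ.tAlgebra.comp_eq_zero_iff, ← φ.map_cp, map_eq_zero_iff φ.map φ.injective]
  rfl

theorem mem_UTpp_iff (φ : BlockEmbedding T s B) {I : Finset (Fin r)}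
    (hI : ∀ i, i ∈ I ↔ i ∉ Set.range φ.idx) (b : B) :
    b ∈ φ.tAlgebra.UTpp ↔ φ.map b ∈ T.principalLTpp I := by
  simp only [TAlgebra.UTpp, Set.mem_ofPred_eq, tAlgebra_comp_eq_zero_iff]
  have hd : ∀ i, φ.tAlgebra.diag i b = T.diag (φ.idx i) (φ.map b) := fun i => φ.diag_eq i b
  simp only [hd, T.mem_principalLTpp, T.mem_lower]
  constructor
  · rintro ⟨h1, h2⟩
    refine ⟨fun i hi k => ⟨φ.cp_map b i k (Or.inl ((hI i).1 hi)),
      φ.cp_map b k i (Or.inr ((hI i).1 hi))⟩, fun i j hij => ?_, fun i hi => ?_⟩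
    · by_cases hi : i ∈ Set.range φ.idx
      · by_cases hj : j ∈ Set.range φ.idx
        · obtain ⟨i, rfl⟩ := hi
          obtain ⟨j, rfl⟩ := hj
          exact h1 i j (φ.strictAnti.lt_iff_gt.1 hij)
        · exact φ.cp_map b i j (Or.inr hj)
      · exact φ.cp_map b i j (Or.inl hi)
    · rw [hI, not_not] at hi
      obtain ⟨i, rfl⟩ := hi
      exact h2 i
  · rintro ⟨-, h1, h2⟩
    refine ⟨fun i j hij => h1 _ _ (φ.strictAnti hij), fun i => h2 _ ?_⟩
    rw [hI, not_not]
    exact ⟨i, rfl⟩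

variable [StarModule ℝ A] [StarModule ℝ B]

/-- The restriction of a block embedding to the Hermitian elements. -/
def hermMap (φ : BlockEmbedding T s B) : Herm B →ₗ[ℝ] Herm A :=
  φ.map.restrict fun x hx => by
    change star (φ.map x) = φ.map x
    rw [← φ.map_star]
    exact congrArg φ.map hx

theorem hermMap_injective (φ : BlockEmbedding T s B) : Function.Injective φ.hermMap :=
  fun _ _ h => Subtype.ext (φ.injective (congrArg Subtype.val h))

theorem hermMap_image_cone (φ : BlockEmbedding T s B) {I : Finset (Fin r)}
    (hI : ∀ i, i ∈ I ↔ i ∉ Set.range φ.idx) :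
    φ.hermMap '' φ.tAlgebra.cone = T.principalDual I := by
  have h : ∀ b : B, φ.hermMap (mulStar b) = mulStar (φ.map b) := fun b =>
    Subtype.ext (by
      change φ.map (b * star b) = φ.map b * star (φ.map b)
      rw [φ.map_mul, φ.map_star])
  ext y
  constructor
  · rintro ⟨_, ⟨b, hb, rfl⟩, rfl⟩
    exact ⟨_, (φ.mem_UTpp_iff hI b).1 hb, (h b).symm⟩
  · rintro ⟨t, ht, rfl⟩
    obtain ⟨b, rfl⟩ := φ.exists_map_eq t fun i j hij => by
      rw [T.mem_principalLTpp] at ht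
      rcases hij with hi | hj
      · exact (ht.1 i ((hI i).2 hi) j).1
      · exact (ht.1 j ((hI j).2 hj) i).2
    exact ⟨_, ⟨b, (φ.mem_UTpp_iff hI b).2 ht, rfl⟩, h b⟩

end BlockEmbedding

namespace TAlgebra

variable {r : ℕ} {A : Type*} [NonUnitalNonAssocRing A] [StarRing A] [Module ℝ A]

/-- The T-algebra with the reversed order of the indices. -/
noncomputable def rev (T : TAlgebra r A) : TAlgebra r A :=
  BlockEmbedding.tAlgebra (T := T) (s := r) (B := A)
    { map := LinearMap.id
      injective := Function.injective_id
      map_mul := fun _ _ => rfl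
      map_star := fun _ => rfl
      idx := Fin.rev
      strictAnti := Fin.rev_strictAnti
      cp_map := fun b i j h => by
        rcases h with h | h
        · exact absurd (Fin.rev_surjective i) h
        · exact absurd (Fin.rev_surjective j) h
      exists_map_eq := fun a _ => ⟨a, rfl⟩ }

theorem mem_rev_principalLTpp (T : TAlgebra r A) (b : A) :
    b ∈ T.rev.principalLTpp ∅ ↔ b ∈ T.UTpp := by
  have h1 : ∀ i j, T.rev.comp i j b = 0 ↔ T.cp i.rev j.rev b = 0 := fun i j =>
    BlockEmbedding.tAlgebra_comp_eq_zero_iff _ i j b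
  have h2 : ∀ i, T.rev.diag i b = T.diag i.rev b := fun i => BlockEmbedding.diag_eq _ i b
  simp only [principalLTpp, principal, UTpp, Set.mem_ofPred_eq, h1, h2, T.comp_eq_zero_iff,
    Finset.notMem_empty, false_implies, implies_true, true_and, not_false_eq_true, forall_const]
  refine and_congr ⟨fun h i j hij => ?_, fun h i j hij => ?_⟩ ⟨fun h i => ?_, fun h i => h _⟩
  · have := h i.rev j.rev (Fin.rev_lt_rev.2 hij)
    rwa [Fin.rev_rev, Fin.rev_rev] at this
  · exact h _ _ (Fin.rev_lt_rev.2 hij)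
  · have := h i.rev
    rwa [Fin.rev_rev] at this

/-- The principal subalgebra `A_I`, as a `*`-subalgebra. -/
noncomputable def principalSubalgebra (T : TAlgebra r A) (I : Finset (Fin r)) :
    NonUnitalStarSubalgebra ℝ A where
  carrier := T.principal I
  add_mem' := by
    intro a b ha hb i hi k
    simp only [map_add, (ha i hi k).1, (ha i hi k).2, (hb i hi k).1, (hb i hi k).2, add_zero,
      and_self]
  zero_mem' := by
    intro i _ k
    simp
  mul_mem' := by
    intro a b ha hb i hi k
    rw [T.comp_eq_zero_iff, T.comp_eq_zero_iff, T.cp_mul, T.cp_mul]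
    refine ⟨Finset.sum_eq_zero fun j _ => ?_, Finset.sum_eq_zero fun j _ => ?_⟩
    · rw [T.comp_eq_zero_iff.1 (ha i hi j).1, zero_mul]
    · rw [T.comp_eq_zero_iff.1 (hb i hi j).2, mul_zero]
  smul_mem' := by
    intro c a ha i hi k
    simp only [map_smul, (ha i hi k).1, (ha i hi k).2, smul_zero, and_self]
  star_mem' := by
    intro a ha i hi k
    rw [T.comp_eq_zero_iff, T.comp_eq_zero_iff, T.cp_star, T.cp_star, star_eq_zero, star_eq_zero,
      ← T.comp_eq_zero_iff, ← T.comp_eq_zero_iff]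
    exact (ha i hi k).symm

/-- The principal subalgebra `A_I` as a T-algebra of rank `r - |I|`, whose indices are the elements
of the complement of `I` in decreasing order. -/
noncomputable def principalEmbedding (T : TAlgebra r A) (I : Finset (Fin r)) :
    BlockEmbedding T (r - I.card) (T.principalSubalgebra I) :=
  have hcard : Iᶜ.card = r - I.card := by rw [Finset.card_compl, Fintype.card_fin]
  have hrange : ∀ i, i ∉ Set.range (fun j : Fin (r - I.card) =>
      Finset.orderEmbOfFin Iᶜ hcard j.rev) → i ∈ I := fun i hi => by
    by_contra h
    apply hi
    have : i ∈ Set.range (Finset.orderEmbOfFin Iᶜ hcard) := by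
      rw [Finset.range_orderEmbOfFin]
      simpa using h
    obtain ⟨j, hj⟩ := this
    exact ⟨j.rev, by simp only [Fin.rev_rev, hj]⟩
  { map := (T.principalSubalgebra I).toNonUnitalSubalgebra.toSubmodule.subtype
    injective := Subtype.val_injective
    map_mul := fun _ _ => rfl
    map_star := fun _ => rfl
    idx := fun j => Finset.orderEmbOfFin Iᶜ hcard j.rev
    strictAnti := fun i j hij => (Finset.orderEmbOfFin Iᶜ hcard).strictMono
      (Fin.rev_lt_rev.2 hij)
    cp_map := fun b i j h => by
      rcases h with h | h
      · exact T.comp_eq_zero_iff.1 (b.2 i (hrange i h) j).1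
      · exact T.comp_eq_zero_iff.1 (b.2 j (hrange j h) i).2
    exists_map_eq := fun a ha => by
      refine ⟨⟨a, fun i hi k => ?_⟩, rfl⟩
      have hi' : i ∉ Set.range (fun j : Fin (r - I.card) =>
          Finset.orderEmbOfFin Iᶜ hcard j.rev) := by
        rintro ⟨j, rfl⟩
        have := Finset.orderEmbOfFin_mem Iᶜ hcard j.rev
        rw [Finset.mem_compl] at this
        exact this hi
      rw [T.comp_eq_zero_iff, T.comp_eq_zero_iff]
      exact ⟨ha i k (Or.inl hi'), ha k i (Or.inr hi')⟩ }

theorem mem_iff_notMem_range (T : TAlgebra r A) (I : Finset (Fin r)) (i : Fin r) :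
    i ∈ I ↔ i ∉ Set.range (T.principalEmbedding I).idx := by
  have hcard : Iᶜ.card = r - I.card := by rw [Finset.card_compl, Fintype.card_fin]
  have h : Set.range (T.principalEmbedding I).idx =
      Set.range (Finset.orderEmbOfFin Iᶜ hcard) := by
    change Set.range (Finset.orderEmbOfFin Iᶜ hcard ∘ Fin.rev) = _
    exact Fin.rev_surjective.range_comp _
  rw [h, Finset.range_orderEmbOfFin]
  simp

end TAlgebra

/-! ### The rank is the length of the longest chain of faces -/

/-- A chain of `n + 1` elements of `C` that generate strictly increasing faces. -/
def HasConeChain {E : Type*} [AddCommGroup E] [Module ℝ E] (C : Set E) (n : ℕ) : Prop :=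
  ∃ x : ℕ → E, (∀ i ≤ n, x i ∈ C) ∧
    ∀ i < n, ConeDominated C (x i) (x (i + 1)) ∧ ¬ ConeDominated C (x (i + 1)) (x i)

/-- The elements `y` with `y + O ⊆ O`. This recovers a closed convex cone from its relative
interior without reference to a topology. -/
def translators {E : Type*} [AddCommGroup E] (O : Set E) : Set E := {y | ∀ x ∈ O, y + x ∈ O}

theorem hasConeChain_image_iff {E E' : Type*} [AddCommGroup E] [Module ℝ E] [AddCommGroup E']
    [Module ℝ E'] (φ : E →ₗ[ℝ] E') (hφ : Function.Injective φ) (C : Set E) (n : ℕ) :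
    HasConeChain (φ '' C) n ↔ HasConeChain C n := by
  constructor
  · rintro ⟨x, h1, h2⟩
    have h3 : ∀ i, ∃ y, i ≤ n → y ∈ C ∧ φ y = x i := fun i => by
      by_cases hi : i ≤ n
      · obtain ⟨y, hy⟩ := h1 i hi
        exact ⟨y, fun _ => hy⟩
      · exact ⟨0, fun h => absurd h hi⟩
    choose y hy using h3
    refine ⟨y, fun i hi => (hy i hi).1, fun i hi => ?_⟩
    have h4 := h2 i hi
    rwa [← (hy i hi.le).2, ← (hy (i + 1) hi).2, coneDominated_image_iff φ hφ,
      coneDominated_image_iff φ hφ] at h4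
  · rintro ⟨x, h1, h2⟩
    refine ⟨fun i => φ (x i), fun i hi => ⟨_, h1 i hi, rfl⟩, fun i hi => ?_⟩
    rw [coneDominated_image_iff φ hφ, coneDominated_image_iff φ hφ]
    exact h2 i hi

theorem translators_image {E E' : Type*} [AddCommGroup E] [Module ℝ E] [AddCommGroup E']
    [Module ℝ E'] (φ : E →ₗ[ℝ] E') (hφ : Function.Injective φ) {O : Set E} (hO : O.Nonempty) :
    translators (φ '' O) = φ '' translators O := by
  ext y
  constructor
  · intro hy
    obtain ⟨x, hx⟩ := hO
    obtain ⟨z, hz, hzy⟩ := hy _ ⟨x, hx, rfl⟩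
    have h1 : φ (z - x) = y := by rw [map_sub, hzy, add_sub_cancel_right]
    refine ⟨z - x, fun w hw => ?_, h1⟩
    obtain ⟨v, hv, hvw⟩ := hy _ ⟨w, hw, rfl⟩
    rw [← h1, ← map_add] at hvw
    rwa [← hφ hvw]
  · rintro ⟨y, hy, rfl⟩ _ ⟨x, hx, rfl⟩
    exact ⟨y + x, hy x hx, map_add φ y x⟩

namespace TAlgebra

variable {r : ℕ} {A : Type*} [NonUnitalNonAssocRing A] [StarRing A] [Module ℝ A]
  [IsScalarTower ℝ A A] [SMulCommClass ℝ A A] [StarModule ℝ A] [FiniteDimensional ℝ A]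

theorem zeros_mul (T : TAlgebra r A) {l t : A} (hl : l ∈ T.LTpp) (ht : t ∈ T.lower) :
    T.zeros (l * t) = T.zeros t := by
  rw [mem_LTpp] at hl
  ext i
  rw [mem_zeros, mem_zeros, T.diag_mul hl.1 ht]
  simp [(hl.2 i).ne']

/-- A strictly smaller face has a strictly smaller rank. -/
theorem IsProperLT.card_zeros_lt {T : TAlgebra r A} {t s : A} (ht : T.IsProperLT t)
    (hs : T.IsProperLT s)
    (h : ConeDominated (T.dualCone : Set (Herm A)) (mulStar t) (mulStar s))
    (h' : ¬ ConeDominated (T.dualCone : Set (Herm A)) (mulStar s) (mulStar t)) :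
    (T.zeros s).card < (T.zeros t).card := by
  obtain ⟨l, hl, hls⟩ := hs.exists_normalize
  obtain ⟨m, hm, -, -, h1, h2⟩ := T.exists_quadMap_inv hl
  have htl := (T.isProperLT_iff.1 ht).1
  have hm1 := T.mem_LTpp.1 hm
  rw [← hls, ← h2 (mulStar t), T.coneDominated_quadMap_iff hl] at h h'
  rw [T.quadMap_mulStar hm1.1 htl] at h h'
  have hp := T.isProperLT_mul hm ht
  have hz := T.zeros_mul hm htl
  have h3 := (T.mem_principalFace_iff _ _).2 ⟨T.mulStar_mem_dualCone (T.lower_mul hm1.1 htl), h⟩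
  have h4 := T.mem_principalLTp.1 (hp.mem_principalLTp h3.2)
  refine Finset.card_lt_card (Finset.ssubset_iff_subset_ne.2 ⟨fun i hi => ?_, fun heq => h' ?_⟩)
  · rw [← hz, mem_zeros]
    exact T.diag_eq_zero_of_cp (h4.1 i hi i).1
  · have h5 : m * t ∈ T.principalLTpp (T.zeros s) := by
      refine T.mem_principalLTpp.2 ⟨h4.1, h4.2.1, fun i hi => ?_⟩
      refine lt_of_le_of_ne (h4.2.2 i hi) fun h6 => hi ?_
      rw [heq, ← hz, mem_zeros, h6]
    have h6 : mulStar (m * t) ∈ coneCore (T.principalFace (T.zeros s)) := by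
      rw [← image_principalLTpp]
      exact ⟨_, h5, rfl⟩
    obtain ⟨ε, hε, h7⟩ := h6.2 _ (T.hermIdem_mem_principalFace _)
    exact ⟨ε, hε, h7.1⟩

theorem coneDominated_hermIdem_iff (T : TAlgebra r A) (J J' : Finset (Fin r)) :
    ConeDominated (T.dualCone : Set (Herm A)) (T.hermIdem J) (T.hermIdem J') ↔ J ⊆ J' := by
  have h := T.mem_principalFace_iff J'ᶜ (T.hermIdem J)
  rw [compl_compl] at h
  have h0 := T.hermIdem_mem_dualCone J
  constructor
  · intro hd i hi
    by_contra hi'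
    have := (h.2 ⟨h0, hd⟩).2 i (Finset.mem_compl.2 hi') i
    rw [coe_hermIdem, cp_idem, if_pos ⟨rfl, hi⟩] at this
    exact T.e_ne_zero i this
  · intro hJ
    refine (h.1 ⟨h0, fun i hi k => ?_⟩).2
    rw [coe_hermIdem, cp_idem, if_neg fun h => Finset.mem_compl.1 hi (hJ h.2)]

theorem hasConeChain_dualCone_iff (T : TAlgebra r A) (n : ℕ) :
    HasConeChain (T.dualCone : Set (Herm A)) n ↔ n ≤ r := by
  constructor
  -- The number of vanishing diagonal entries decreases strictly along a chain.
  · rintro ⟨x, h1, h2⟩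
    have h3 : ∀ i, ∃ t, i ≤ n → T.IsProperLT t ∧ mulStar t = x i := fun i => by
      by_cases hi : i ≤ n
      · obtain ⟨t, ht⟩ := T.exists_isProperLT (h1 i hi)
        exact ⟨t, fun _ => ht⟩
      · exact ⟨0, fun h => absurd h hi⟩
    choose t ht using h3
    have h4 : ∀ i ≤ n, (T.zeros (t i)).card + i ≤ r := by
      intro i
      induction i with
      | zero => intro _; simpa using Finset.card_le_univ (T.zeros (t 0))
      | succ i ih =>
        intro hi
        have h5 := ih (by omega)
        have h6 := h2 i hi
        rw [← (ht i (by omega)).2, ← (ht (i + 1) hi).2] at h6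
        have := (ht i (by omega)).1.card_zeros_lt (ht (i + 1) hi).1 h6.1 h6.2
        omega
    have := h4 n le_rfl
    omega
  · intro hn
    refine ⟨fun i => T.hermIdem (Finset.univ.filter fun j => (j : ℕ) < i),
      fun i _ => T.hermIdem_mem_dualCone _, fun i hi => ?_⟩
    rw [coneDominated_hermIdem_iff, coneDominated_hermIdem_iff]
    constructor
    · intro j hj
      simp only [Finset.mem_filter, Finset.mem_univ, true_and] at hj ⊢
      omega
    · intro h
      have : (⟨i, by omega⟩ : Fin r) ∈ Finset.univ.filter fun j : Fin r => (j : ℕ) < i :=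
        h (by simp)
      simp at this

theorem translators_coneCore_dualCone (T : TAlgebra r A) :
    translators (coneCore (T.dualCone : Set (Herm A))) = T.dualCone := by
  have h0 := T.hermIdem_mem_coneCore ∅
  rw [principalFace_empty] at h0
  ext y
  constructor
  · intro hy
    rw [SetLike.mem_coe, mem_dualCone]
    intro u hu
    refine nonneg_of_forall_quadratic_nonneg (c := 0)
      (b := T.inner (mulStar u) (T.hermIdem ∅ᶜ)) fun ε hε => ?_
    have h1 : ε • T.hermIdem ∅ᶜ ∈ coneCore (T.dualCone : Set (Herm A)) := by
      refine ⟨T.dualCone.real_smul_mem hε.le h0.1, fun z hz => ?_⟩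
      obtain ⟨δ, hδ, h⟩ := h0.2 z hz
      refine ⟨ε * δ, mul_pos hε hδ, ?_⟩
      rw [mul_smul, ← smul_sub]
      exact T.dualCone.real_smul_mem hε.le h
    have h2 := T.mem_dualCone.1 (hy _ h1).1 u hu
    rw [map_add, map_smul, smul_eq_mul] at h2
    linarith
  · intro hy x hx
    refine ⟨T.dualCone.add_mem hy hx.1, fun z hz => ?_⟩
    obtain ⟨δ, hδ, h⟩ := hx.2 z hz
    refine ⟨δ, hδ, ?_⟩
    rw [add_sub_assoc]
    exact T.dualCone.add_mem hy h

/-- Reversing the order of the indices exchanges the cone and the interior of the dual cone. -/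
theorem cone_eq_coneCore_rev (T : TAlgebra r A) :
    T.cone = coneCore (T.rev.dualCone : Set (Herm A)) := by
  rw [← T.rev.principalFace_empty, ← image_principalLTpp, cone]
  congr 1
  ext b
  exact (T.mem_rev_principalLTpp b).symm

end TAlgebra

/-- The closed cone recovered from the relative interior of `C` is isomorphic to the dual cone of
the reversed T-algebra. -/
theorem IsRealizedInRank.hasConeChain_iff {E : Type*} [AddCommGroup E] [Module ℝ E]
    [TopologicalSpace E] {C : Set E} {s : ℕ} (h : IsRealizedInRank C s) (n : ℕ) :
    HasConeChain (translators (intrinsicInterior ℝ C)) n ↔ n ≤ s := by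
  obtain ⟨B, _, _, _, _, _, _, _, S, ψ, hψ, h1⟩ := h
  have hne : (coneCore (S.rev.dualCone : Set (Herm B))).Nonempty := by
    have := S.rev.hermIdem_mem_coneCore ∅
    rw [TAlgebra.principalFace_empty] at this
    exact ⟨_, this⟩
  rw [← h1, S.cone_eq_coneCore_rev, translators_image ψ hψ hne,
    S.rev.translators_coneCore_dualCone, hasConeChain_image_iff ψ hψ,
    S.rev.hasConeChain_dualCone_iff]

/-- The rank of a T-algebra is an invariant of its cone. -/
theorem IsRealizedInRank.unique {E : Type*} [AddCommGroup E] [Module ℝ E]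
    [TopologicalSpace E] {C : Set E} {s s' : ℕ} (h : IsRealizedInRank C s)
    (h' : IsRealizedInRank C s') : s' = s := by
  have h1 : ∀ n, n ≤ s ↔ n ≤ s' := fun n => by rw [← h.hasConeChain_iff, h'.hasConeChain_iff]
  exact le_antisymm ((h1 s').2 le_rfl) ((h1 s).1 le_rfl)

/-! ### Structure of a face -/

namespace TAlgebra

variable {r : ℕ} {A : Type*} [NonUnitalNonAssocRing A] [StarRing A] [Module ℝ A]
  [IsScalarTower ℝ A A] [SMulCommClass ℝ A A] [StarModule ℝ A] [FiniteDimensional ℝ A]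

theorem isProjectionallyExposed_image (T : TAlgebra r A) {l : A} (hl : l ∈ T.LTpp)
    (I : Finset (Fin r)) :
    IsProjectionallyExposed (T.dualCone : Set (Herm A)) (quadMap l '' T.principalFace I) := by
  obtain ⟨m, hm, -, -, h1, -⟩ := T.exists_quadMap_inv hl
  refine ⟨quadMap l ∘ₗ quadMap (T.idem Iᶜ) ∘ₗ quadMap m, ?_, ?_⟩
  · rw [LinearMap.coe_comp, LinearMap.coe_comp, Set.image_comp, Set.image_comp,
      T.quadMap_image_dualCone hm, T.quadMap_idem_image]
  · refine LinearMap.ext fun b => ?_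
    simp only [LinearMap.comp_apply]
    rw [h1, T.quadMap_quadMap (T.idem_mem_lower _) (T.idem_mem_lower _), idem_mul_idem]

/-- The conjugate `l n l⁻¹` of an element `n` of the fixer of `I` acts on the image under `Q_l` of
the principal face. -/
theorem quadMap_conj (T : TAlgebra r A) {I : Finset (Fin r)} {l m n : A} (hl : l ∈ T.LTpp)
    (hm : m ∈ T.LTpp) (hml : ∀ b, quadMap m (quadMap l b) = b) (hn : n ∈ T.fixer I) :
    l * (n * m) ∈ T.LTpp ∧
      (∀ b, quadMap (l * (n * m)) (quadMap l b) = quadMap l (quadMap n b)) ∧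
      quadMap (l * (n * m)) '' (quadMap l '' T.principalFace I) =
        quadMap l '' T.principalFace I := by
  have hl1 := (T.mem_LTpp.1 hl).1
  have hm1 := (T.mem_LTpp.1 hm).1
  have hn1 := (T.mem_LTpp.1 hn.1).1
  have h1 : ∀ b, quadMap (l * (n * m)) (quadMap l b) = quadMap l (quadMap n b) := fun b => by
    rw [← T.quadMap_quadMap hl1 (T.lower_mul hn1 hm1), ← T.quadMap_quadMap hn1 hm1, hml]
  refine ⟨T.LTpp_mul hl (T.LTpp_mul hn.1 hm), h1, ?_⟩
  conv_rhs => rw [← T.quadMap_image_principalFace hn]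
  rw [Set.image_image, Set.image_image]
  simp only [h1]

theorem coneCore_image_principalFace (T : TAlgebra r A) {l : A} (hl : l ∈ T.LTpp)
    (I : Finset (Fin r)) :
    coneCore (quadMap l '' T.principalFace I) = quadMap l '' coneCore (T.principalFace I) :=
  coneCore_image _ (T.quadMap_bijective hl).1 _

/-- The group acts transitively on the relative interior of the face. -/
theorem exists_conj_of_mem_coneCore (T : TAlgebra r A) {I : Finset (Fin r)} {l m : A}
    (hl : l ∈ T.LTpp) (hm : m ∈ T.LTpp) (hml : ∀ b, quadMap m (quadMap l b) = b)
    {x y : Herm A} (hx : x ∈ coneCore (quadMap l '' T.principalFace I))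
    (hy : y ∈ coneCore (quadMap l '' T.principalFace I)) :
    ∃ n ∈ T.fixer I, quadMap (l * (n * m)) x = y := by
  rw [T.coneCore_image_principalFace hl] at hx hy
  obtain ⟨x, hx, rfl⟩ := hx
  obtain ⟨y, hy, rfl⟩ := hy
  obtain ⟨a, ha, rfl⟩ := T.exists_fixer_of_mem_coneCore hx
  obtain ⟨b, hb, rfl⟩ := T.exists_fixer_of_mem_coneCore hy
  obtain ⟨a', ha', h1, h2, h3, -⟩ := T.exists_quadMap_inv ha.1
  have h4 := T.mul_mem_fixer hb (T.inv_mem_fixer ha ha' h1 h2)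
  refine ⟨b * a', h4, ?_⟩
  rw [(T.quadMap_conj hl hm hml h4).2.1, ← T.quadMap_quadMap (T.mem_LTpp.1 hb.1).1
    (T.mem_LTpp.1 ha').1, h3]

/-- The group acts freely on the relative interior of the face. -/
theorem eq_of_conj_eq (T : TAlgebra r A) {I : Finset (Fin r)} {l m n n' : A}
    (hl : l ∈ T.LTpp) (hm : m ∈ T.LTpp) (hml : ∀ b, quadMap m (quadMap l b) = b)
    (hn : n ∈ T.fixer I) (hn' : n' ∈ T.fixer I)
    {x : Herm A} (hx : x ∈ coneCore (quadMap l '' T.principalFace I))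
    (h : quadMap (l * (n * m)) x = quadMap (l * (n' * m)) x) : n = n' := by
  rw [T.coneCore_image_principalFace hl] at hx
  obtain ⟨x, hx, rfl⟩ := hx
  obtain ⟨a, ha, rfl⟩ := T.exists_fixer_of_mem_coneCore hx
  rw [(T.quadMap_conj hl hm hml hn).2.1, (T.quadMap_conj hl hm hml hn').2.1] at h
  have h1 := (T.quadMap_bijective hl).1 h
  have ha1 := (T.mem_LTpp.1 ha.1).1
  rw [T.quadMap_quadMap (T.mem_LTpp.1 hn.1).1 ha1,
    T.quadMap_quadMap (T.mem_LTpp.1 hn'.1).1 ha1] at h1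
  have h2 := T.eq_of_quadMap_hermIdem_eq (T.mul_mem_fixer hn ha) (T.mul_mem_fixer hn' ha) h1
  obtain ⟨a', ha', h3, -⟩ := T.exists_inv ha.1
  have h4 := congrArg (· * a') h2
  rwa [T.mul_assoc_lower (T.mem_LTpp.1 hn.1).1 ha1, T.mul_assoc_lower (T.mem_LTpp.1 hn'.1).1 ha1,
    h3, mul_unit, mul_unit] at h4

/-- The index set of a principal face that is a triangular image of `F` is determined by the
proper factors of the elements in the relative interior of `F`. -/
theorem zeros_eq_of_image_eq (T : TAlgebra r A) {F : Set (Herm A)} {l : A} (hl : l ∈ T.LTpp)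
    {I : Finset (Fin r)} (h : quadMap l '' F = T.principalFace I) {t : A} (ht : T.IsProperLT t)
    (hx : mulStar t ∈ coneCore F) : I = T.zeros t := by
  have htl := (T.isProperLT_iff.1 ht).1
  have h1 : quadMap l (mulStar t) ∈ coneCore (T.principalFace I) := by
    rw [← h, coneCore_image _ (T.quadMap_bijective hl).1]
    exact ⟨_, hx, rfl⟩
  rw [T.quadMap_mulStar (T.mem_LTpp.1 hl).1 htl, ← image_principalLTpp] at h1
  obtain ⟨p, hp, hpt⟩ := h1
  obtain ⟨h2, h3⟩ := T.isProperLT_of_mem_principalLTpp hp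
  rw [← h3, h2.unique (T.isProperLT_mul hl ht) hpt, T.zeros_mul hl htl]

/-- The group of the linear bijections of `V` that are restrictions of `Q_{l n m}`, where `n` lies in
the fixer of `I` and `Q_m` is inverse to `Q_l`. -/
def faceGroup (T : TAlgebra r A) {I : Finset (Fin r)} {l m : A} (hl : l ∈ T.LTpp)
    (hm : m ∈ T.LTpp) (hlm : ∀ b, quadMap l (quadMap m b) = b)
    (hml : ∀ b, quadMap m (quadMap l b) = b) (V : Submodule ℝ (Herm A)) :
    Subgroup (V ≃ₗ[ℝ] V) where
  carrier := {g | ∃ n ∈ T.fixer I, ∀ x : V, (g x : Herm A) = quadMap (l * (n * m)) x}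
  one_mem' := ⟨T.unit, T.unit_mem_fixer I, fun x => by
    have := (T.quadMap_conj hl hm hml (T.unit_mem_fixer I)).2.1 (quadMap m x)
    rw [hlm, quadMap_unit, hlm] at this
    exact this.symm⟩
  mul_mem' := by
    rintro g g' ⟨n, hn, h⟩ ⟨n', hn', h'⟩
    refine ⟨n * n', T.mul_mem_fixer hn hn', fun x => ?_⟩
    have h1 := (T.quadMap_conj hl hm hml hn).2.1
    have h2 := (T.quadMap_conj hl hm hml hn').2.1 (quadMap m x)
    have h3 := (T.quadMap_conj hl hm hml (T.mul_mem_fixer hn hn')).2.1 (quadMap m x)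
    rw [hlm] at h2 h3
    rw [LinearEquiv.mul_apply, h, h', h2, h1, h3,
      T.quadMap_quadMap (T.mem_LTpp.1 hn.1).1 (T.mem_LTpp.1 hn'.1).1]
  inv_mem' := by
    rintro g ⟨n, hn, h⟩
    obtain ⟨n', hn', h1, h2, h3, -⟩ := T.exists_quadMap_inv hn.1
    have hf := T.inv_mem_fixer hn hn' h1 h2
    refine ⟨n', hf, fun x => ?_⟩
    have h4 := h (g⁻¹ x)
    have h5 : g (g⁻¹ x) = x := g.apply_symm_apply x
    have h6 := (T.quadMap_conj hl hm hml hn).2.1 (quadMap m (g⁻¹ x : V))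
    rw [hlm] at h6
    rw [h5, h6] at h4
    rw [h4, (T.quadMap_conj hl hm hml hf).2.1, h3, hlm]

end TAlgebra

/-- A linear bijection mapping a set onto itself restricts to the span of this set. -/
theorem exists_restrict_span {E : Type*} [AddCommGroup E] [Module ℝ E] (φ : E →ₗ[ℝ] E)
    (hφ : Function.Bijective φ) {F : Set E} (h : φ '' F = F) :
    ∃ g : Submodule.span ℝ F ≃ₗ[ℝ] Submodule.span ℝ F, ∀ x, (g x : E) = φ x := by
  have h1 : (Submodule.span ℝ F).map (LinearEquiv.ofBijective φ hφ : E →ₗ[ℝ] E) =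
      Submodule.span ℝ F := by
    rw [Submodule.map_span]
    exact congrArg _ h
  exact ⟨LinearEquiv.ofSubmodules (LinearEquiv.ofBijective φ hφ) _ _ h1, fun x => rfl⟩

theorem theorem3p10 {r : ℕ} {A : Type*} [NonUnitalNonAssocRing A] [StarRing A] [Module ℝ A]
    [IsScalarTower ℝ A A] [SMulCommClass ℝ A A] [StarModule ℝ A] [FiniteDimensional ℝ A]
    [TopologicalSpace A] [IsTopologicalAddGroup A] [ContinuousSMul ℝ A] [T2Space A]
    (T : TAlgebra r A) (F : PointedCone ℝ (Herm A))
    (hF : F.IsFaceOf T.dualCone) (hproper : F ≠ T.dualCone) :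
    -- projectional exposedness
    IsProjectionallyExposed (T.dualCone : Set (Herm A)) (F : Set (Herm A)) ∧
    -- homogeneity, rank and the principal dual face
    (∃ s : ℕ, s < r ∧ IsHomogeneousCone (F : Set (Herm A)) ∧
      HasHomogeneousRank (F : Set (Herm A)) s ∧
      (∃ (Q : Herm A →ₗ[ℝ] Herm A) (I : Finset (Fin r)), T.IsTriangularDualAut Q ∧ I.Nonempty ∧
        Q '' (F : Set (Herm A)) = closure (T.principalDual I) ∧
        closure (T.principalDual I) = mulStar '' T.principalLTp I) ∧
      (∀ x ∈ intrinsicInterior ℝ (F : Set (Herm A)), ∃! t : A, T.IsProperLT t ∧ x = mulStar t) ∧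
      (∀ (Q : Herm A →ₗ[ℝ] Herm A) (I : Finset (Fin r)), T.IsTriangularDualAut Q →
        Q '' (F : Set (Herm A)) = closure (T.principalDual I) →
        ∀ x ∈ intrinsicInterior ℝ (F : Set (Herm A)), ∀ t : A, T.IsProperLT t → x = mulStar t →
          (∀ i, i ∈ I ↔ T.diag i t = 0) ∧ s = r - I.card)) ∧
    -- a simply transitive group of restricted triangular automorphisms
    (∃ G : Subgroup (Submodule.span ℝ (F : Set (Herm A)) ≃ₗ[ℝ]
          Submodule.span ℝ (F : Set (Herm A))),
      (∀ g ∈ G, IsConeAut (Subtype.val ⁻¹' (F : Set (Herm A)))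
        (g : Submodule.span ℝ (F : Set (Herm A)) →ₗ[ℝ] Submodule.span ℝ (F : Set (Herm A)))) ∧
      (∀ x y : Submodule.span ℝ (F : Set (Herm A)),
        (x : Herm A) ∈ intrinsicInterior ℝ (F : Set (Herm A)) →
        (y : Herm A) ∈ intrinsicInterior ℝ (F : Set (Herm A)) → ∃! g, g ∈ G ∧ g x = y) ∧
      (∀ g ∈ G, ∃ Q : Herm A →ₗ[ℝ] Herm A, T.IsTriangularDualAut Q ∧
        ∀ x : Submodule.span ℝ (F : Set (Herm A)), (x : Herm A) ∈ F → (g x : Herm A) = Q x)) := by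
  obtain ⟨l, hl, I, hFI⟩ := T.exists_eq_image_principalFace hF
  obtain ⟨m, hm, -, -, hml, hlm⟩ := T.exists_quadMap_inv hl
  have hri := F.intrinsicInterior_eq_coneCore
  have hri' : intrinsicInterior ℝ (F : Set (Herm A)) =
      coneCore (quadMap l '' T.principalFace I) := by rw [hri, hFI]
  have hmF : quadMap m '' (F : Set (Herm A)) = T.principalFace I := by
    rw [hFI, Set.image_image]
    simp only [hml, Set.image_id']
  have hI : I.Nonempty := by
    rw [Finset.nonempty_iff_ne_empty]
    rintro rfl
    apply hproper
    apply SetLike.coe_injective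
    rw [hFI, T.principalFace_empty, T.quadMap_image_dualCone hl]
  have hrank : IsRealizedInRank (F : Set (Herm A)) (r - I.card) := by
    refine ⟨T.principalSubalgebra I, inferInstance, inferInstance, inferInstance, inferInstance,
      inferInstance, inferInstance,
      inferInstanceAs (FiniteDimensional ℝ
        (T.principalSubalgebra I).toNonUnitalSubalgebra.toSubmodule), (T.principalEmbedding I).tAlgebra,
      quadMap l ∘ₗ (T.principalEmbedding I).hermMap,
      (T.quadMap_bijective hl).1.comp (T.principalEmbedding I).hermMap_injective, ?_⟩
    rw [LinearMap.coe_comp, Set.image_comp,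
      (T.principalEmbedding I).hermMap_image_cone (T.mem_iff_notMem_range I), T.principalDual_eq,
      hri', T.coneCore_image_principalFace hl]
  refine ⟨by rw [hFI]; exact T.isProjectionallyExposed_image hl I,
    ⟨r - I.card, ?_, ?_, ⟨?_, ?_⟩, ⟨quadMap m, I, T.isTriangularDualAut_quadMap hm, hI, ?_, ?_⟩,
      ?_, ?_⟩, T.faceGroup (I := I) hl hm hlm hml _, ?_, ?_, ?_⟩
  · have h1 := hI.card_pos
    have h2 : I.card ≤ r := by simpa using Finset.card_le_univ I
    omega
  · intro x hx y hy
    rw [hri, hFI] at hx hy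
    obtain ⟨n, hn, h⟩ := T.exists_conj_of_mem_coneCore hl hm hml hx hy
    obtain ⟨h1, -, h3⟩ := T.quadMap_conj hl hm hml hn
    exact ⟨_, ⟨T.quadMap_bijective h1, by rw [hFI]; exact h3⟩, h⟩
  · exact hrank
  · exact fun s' hs' => hrank.unique hs'
  · rw [hmF, T.closure_principalDual]
  · rw [T.closure_principalDual, T.image_principalLTp]
  · intro x hx
    obtain ⟨t, ht, rfl⟩ := T.exists_isProperLT (hF.le (intrinsicInterior_subset hx))
    exact ⟨t, ⟨ht, rfl⟩, fun s hs => (ht.unique hs.1 hs.2).symm⟩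
  · rintro Q I' ⟨-, l', hl', rfl⟩ hQ x hx t ht rfl
    rw [T.closure_principalDual] at hQ
    rw [hri] at hx
    have h1 := T.zeros_eq_of_image_eq hl' hQ ht hx
    have h2 := T.zeros_eq_of_image_eq hm hmF ht hx
    exact ⟨fun i => by rw [h1, T.mem_zeros], by rw [h1, h2]⟩
  · rintro g ⟨n, hn, h⟩
    obtain ⟨-, -, h3⟩ := T.quadMap_conj hl hm hml hn
    rw [← hFI] at h3
    refine ⟨g.bijective, ?_⟩
    ext y
    constructor
    · rintro ⟨x, hx, rfl⟩
      change (g x : Herm A) ∈ (F : Set (Herm A))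
      rw [h]
      exact h3.subset ⟨_, hx, rfl⟩
    · intro hy
      obtain ⟨x, hx, hxy⟩ := h3.symm.subset hy
      refine ⟨⟨x, Submodule.subset_span hx⟩, hx, Subtype.ext ?_⟩
      exact (h _).trans hxy
  · intro x y hx hy
    replace hx := hri'.subset hx
    obtain ⟨n, hn, h⟩ := T.exists_conj_of_mem_coneCore hl hm hml hx (hri'.subset hy)
    obtain ⟨h1, -, h3⟩ := T.quadMap_conj hl hm hml hn
    rw [← hFI] at h3
    obtain ⟨g, hg⟩ := exists_restrict_span _ (T.quadMap_bijective h1) h3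
    refine ⟨g, ⟨⟨n, hn, hg⟩, Subtype.ext ((hg x).trans h)⟩, ?_⟩
    rintro g' ⟨⟨n', hn', hg'⟩, hxy⟩
    have h4 : n' = n := T.eq_of_conj_eq hl hm hml hn' hn hx (by rw [← hg', hxy, h])
    subst h4
    exact LinearEquiv.ext fun z => Subtype.ext ((hg' z).trans (hg z).symm)
  · rintro g ⟨n, hn, h⟩
    exact ⟨_, T.isTriangularDualAut_quadMap (T.quadMap_conj hl hm hml hn).1, fun x _ => h x⟩
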